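/- **Proposition 1.1 (Existence and uniqueness).** For a probability measure $\mu$ on $[0,\infty)$ with mean $m_\mu=\int_0^\infty x\,\mu(dx)\in(0,\infty)$, let $\mu_{sb}(dx)=m_\mu^{-1}x\,\mu(dx)$ denote its size-biased distribution. Let $A\ge 0$ be a random variable with $\mathbb P(A=0)=0$ whose logarithmic expectation $\mathbb E\log A$ exists in $[-\infty,+\infty]$ (that is, $\mathbb E\log^+A$ and $\mathbb E\log^-A$ are not both infinite). By a non-zero solution we mean a probability measure $\mu\neq\delta_0$ on $[0,\infty)$ with finite mean such that $$\eta_{sb}\overset{d}{=}A\,\eta_{sb}+\eta ,$$ where on the right-hand side $A$, $\eta_{sb}$ and $\eta$ are independent, $\eta$ has distribution $\mu$ and $\eta_{sb}$ has distribution $\mu_{sb}$. Then a non-zero solution $\mu$ exists if and only if $\mathbb E\log A<0$ (the value $-\infty$ being allowed). Moreover, if $\mathbb E\log A<0$, then for every $m\in(0,\infty)$ there is exactly one non-zero solution $\mu$ with mean $m$. -/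

import Mathlib

open MeasureTheory
open scoped ENNReal

namespace SizeBiasedPerpetuity

/-- The expectation of `f` exists, finite or infinite: the positive and the negative part of `f`
do not both have infinite expectation. -/
def ExpectationExists {Ω : Type*} [MeasurableSpace Ω] (P : Measure Ω) (f : Ω → ℝ) : Prop :=
  ∫⁻ ω, ENNReal.ofReal (f ω) ∂P ≠ ∞ ∨ ∫⁻ ω, ENNReal.ofReal (-f ω) ∂P ≠ ∞

/-- The expectation of `f` with values in `[-∞, ∞]`, namely `E f⁺ - E f⁻`. It is meaningful when
`ExpectationExists P f` holds. -/
noncomputable def extendedExpectation {Ω : Type*} [MeasurableSpace Ω] (P : Measure Ω)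
    (f : Ω → ℝ) : EReal :=
  ((∫⁻ ω, ENNReal.ofReal (f ω) ∂P : ℝ≥0∞) : EReal) -
    ((∫⁻ ω, ENNReal.ofReal (-f ω) ∂P : ℝ≥0∞) : EReal)

/-- The mean, in `[0, ∞]`, of a measure carried by `[0, ∞)`. -/
noncomputable def mean (μ : Measure ℝ) : ℝ≥0∞ := ∫⁻ x, ENNReal.ofReal x ∂μ

/-- The size-biased distribution `μ_sb(dx) = m⁻¹ x μ(dx)`, where `m` is the mean of `μ`; it is
meaningful for a probability measure on `[0, ∞)` with mean in `(0, ∞)`. -/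
noncomputable def sizeBiased (μ : Measure ℝ) : Measure ℝ :=
  (mean μ)⁻¹ • μ.withDensity (fun x => ENNReal.ofReal x)

/-- `μ` is a non-zero solution for the law `ρ` of `A`: it is the law of a non-negative random
variable `η` of finite mean, not almost surely zero, and `η_sb` has the same distribution as
`A * η_sb + η`, where on the right-hand side `A`, `η_sb`, `η` are independent with laws `ρ`,
`μ_sb`, `μ` (so that their joint law is the product measure). -/
structure IsNonzeroSolution (ρ μ : Measure ℝ) : Prop where
  isProbabilityMeasure : IsProbabilityMeasure μ
  nonneg : μ (Set.Iio 0) = 0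
  mean_ne_top : mean μ ≠ ∞
  ne_dirac_zero : μ ≠ Measure.dirac 0
  equation : sizeBiased μ =
    (ρ.prod ((sizeBiased μ).prod μ)).map (fun p : ℝ × ℝ × ℝ => p.1 * p.2.1 + p.2.2)

end SizeBiasedPerpetuity

namespace SizeBiasedPerpetuity
open Filter Topology

/-! ### Translation increments of bounded monotone functions -/

/-! Write `A = e^y` with `y` of law `τ`, and let `φ` be the Laplace transform of `μ`, of mean `m`.
Since `-φ'/m` is the transform of the size-biased law, the equation reads `-φ'(s) = φ(s)
E[-φ'(sA)]`, and integrating from `0` gives `φ(s) = exp(-E[(1 - φ(sA))/A])`. In terms of the profile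
`h(x) = (1 - φ(e^x))/e^x`, which decreases from `m` at `-∞` to `0` at `+∞`, this is the fixed-point
equation `h(x) = expQuot x (E h(x + y))` of `step`.

Everything about the sign of `E y` rests on one identity: a bounded monotone `f` with limits `a` and
`b` satisfies `∫ (f(x + y) - f(x)) dx = (b - a) y`. Averaging over `y` and treating positive and
negative increments separately turns pointwise sub- or superharmonicity into an inequality between
the two parts of the drift (`drift_le_of_subharmonic`, `drift_lt_of_superharmonic`), valid even for
infinite values.

Necessity: `expQuot x u < u` for `u > 0`, so `-h` is strictly superharmonic and `E y < 0`.

Existence: iterating `step` from the profile of the point mass at `1` gives a decreasing sequence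
whose limit is a fixed point. If the limit were zero, the defects `E h_n(x + y) - h_{n+1}(x)` would
have integrals tending to zero by domination, while the drift inequality bounds these integrals
below by `-E y > 0`. Domination needs the negative part of `y` to be integrable, which truncation
arranges. The limit comes from a probability measure because `step` preserves Laplace transforms,
through a compound Poisson approximation. Scaling then yields every mean.

Uniqueness: `expQuot x` is non-expansive, so the distance between two profiles is bounded and
subharmonic; for equal means it vanishes at `-∞`. Its running supremum is monotone and subharmonic,
and negative drift forces it to be zero. -/

lemma tendsto_intervalIntegral_translate {f : ℝ → ℝ} (hf : Monotone f) {l : Filter ℝ} [l.NeBot]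
    [l.IsCountablyGenerated] {b c B : ℝ} (hB : ∀ x, |f x| ≤ B)
    (hl : ∀ x, Tendsto (fun r => x + r) l l) (hb : Tendsto f l (𝓝 b)) :
    Tendsto (fun r => ∫ x in r..(r + c), f x) l (𝓝 (c * b)) := by
  have h1 : ∀ r, ∫ x in r..(r + c), f x = ∫ x in (0 : ℝ)..c, f (x + r) := by
    intro r
    rw [intervalIntegral.integral_comp_add_right]
    simp [add_comm]
  simp_rw [h1]
  have h2 : c * b = ∫ _ in (0 : ℝ)..c, b := by simp
  rw [h2]
  refine intervalIntegral.tendsto_integral_filter_of_dominated_convergence (fun _ => B) ?_ ?_ ?_ ?_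
  · exact Eventually.of_forall fun r =>
      (hf.measurable.comp (measurable_id.add_const r)).aestronglyMeasurable
  · exact Eventually.of_forall fun r => Eventually.of_forall fun x _ => hB _
  · simp
  · exact Eventually.of_forall fun x _ => hb.comp (hl x)

lemma abs_le_of_monotone_of_tendsto {f : ℝ → ℝ} (hf : Monotone f) {a b : ℝ}
    (ha : Tendsto f atBot (𝓝 a)) (hb : Tendsto f atTop (𝓝 b)) (x : ℝ) :
    |f x| ≤ |a| + |b| := by
  have h1 : a ≤ f x := hf.le_of_tendsto ha x
  have h2 : f x ≤ b := hf.ge_of_tendsto hb x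
  rw [abs_le]
  constructor
  · linarith [neg_abs_le a, abs_nonneg b]
  · linarith [le_abs_self b, abs_nonneg a]

/-- Over the window `(-r, r]` the increments telescope to two integrals of `f` over intervals of
length `c`, one at each end. These tend to `c * b` and `c * a`. -/
lemma lintegral_translate_sub {f : ℝ → ℝ} (hf : Monotone f) {a b c : ℝ}
    (ha : Tendsto f atBot (𝓝 a)) (hb : Tendsto f atTop (𝓝 b)) (hc : 0 ≤ c) :
    ∫⁻ x, ENNReal.ofReal (f (x + c) - f x) = ENNReal.ofReal (b - a) * ENNReal.ofReal c := by
  have hB := abs_le_of_monotone_of_tendsto hf ha hb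
  have hab : a ≤ b := (hf.le_of_tendsto ha 0).trans (hf.ge_of_tendsto hb 0)
  have hm : Measurable fun x => f (x + c) := hf.measurable.comp (measurable_id.add_const c)
  have hfi : ∀ u v : ℝ, IntervalIntegrable f volume u v := fun u v => hf.intervalIntegrable
  have hfi' : ∀ u v : ℝ, IntervalIntegrable (fun x => f (x + c)) volume u v := fun u v =>
    Monotone.intervalIntegrable fun x y h => hf (by linarith)
  have hcover : AECover (volume : Measure ℝ) atTop fun r : ℝ => Set.Ioc (-r) r :=
    aecover_Ioc tendsto_neg_atTop_atBot tendsto_id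
  have hlim := hcover.lintegral_tendsto_of_countably_generated
    (f := fun x => ENNReal.ofReal (f (x + c) - f x))
    (hm.sub hf.measurable).ennreal_ofReal.aemeasurable
  refine tendsto_nhds_unique hlim ?_
  have heq : ∀ᶠ r : ℝ in atTop, ∫⁻ x in Set.Ioc (-r) r, ENNReal.ofReal (f (x + c) - f x) =
      ENNReal.ofReal ((∫ x in r..(r + c), f x) - ∫ x in (-r)..(-r + c), f x) := by
    filter_upwards [eventually_ge_atTop 0] with r hr
    have hrr : -r ≤ r := by linarith
    rw [← ofReal_integral_eq_lintegral_ofReal]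
    · rw [← intervalIntegral.integral_of_le hrr, intervalIntegral.integral_sub (hfi' _ _) (hfi _ _),
        intervalIntegral.integral_comp_add_right]
      congr 1
      have e1 := intervalIntegral.integral_add_adjacent_intervals (hfi (-r) r) (hfi r (r + c))
      have e2 := intervalIntegral.integral_add_adjacent_intervals (hfi (-r) (-r + c))
        (hfi (-r + c) (r + c))
      linarith
    · exact ((intervalIntegrable_iff_integrableOn_Ioc_of_le hrr).1 ((hfi' _ _).sub (hfi _ _)))
    · exact Eventually.of_forall fun x => sub_nonneg.2 (hf (by simpa using hc))
  refine Tendsto.congr' (EventuallyEq.symm heq) ?_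
  rw [← ENNReal.ofReal_mul (by linarith)]
  refine ENNReal.tendsto_ofReal ?_
  have t1 := tendsto_intervalIntegral_translate (c := c) hf hB
    (fun x => tendsto_atTop_add_const_left _ x tendsto_id) hb
  have t2 := (tendsto_intervalIntegral_translate (c := c) hf hB
    (fun x => tendsto_atBot_add_const_left _ x tendsto_id) ha).comp tendsto_neg_atTop_atBot
  have := t1.sub t2
  rw [show (b - a) * c = c * b - c * a by ring]
  exact this

/-- By Tonelli each `y ≥ 0` contributes `(b - a) y`; for `y ≤ 0` monotonicity makes every increment
non-positive, so nothing is contributed. -/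
lemma lintegral_lintegral_increment_pos {f : ℝ → ℝ} (hf : Monotone f) {a b : ℝ}
    (ha : Tendsto f atBot (𝓝 a)) (hb : Tendsto f atTop (𝓝 b)) (τ : Measure ℝ) [SFinite τ] :
    ∫⁻ x, ∫⁻ y, ENNReal.ofReal (f (x + y) - f x) ∂τ =
      ENNReal.ofReal (b - a) * ∫⁻ y, ENNReal.ofReal y ∂τ := by
  have hm := hf.measurable
  rw [lintegral_lintegral_swap (by fun_prop), ← lintegral_const_mul _ (by fun_prop)]
  refine lintegral_congr fun y => ?_
  rcases le_total 0 y with hy | hy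
  · exact lintegral_translate_sub hf ha hb hy
  · rw [ENNReal.ofReal_of_nonpos hy, mul_zero]
    refine (lintegral_congr fun x => ?_).trans lintegral_zero
    exact ENNReal.ofReal_of_nonpos (sub_nonpos.2 (hf (by linarith)))

lemma lintegral_lintegral_increment_neg {f : ℝ → ℝ} (hf : Monotone f) {a b : ℝ}
    (ha : Tendsto f atBot (𝓝 a)) (hb : Tendsto f atTop (𝓝 b)) (τ : Measure ℝ) [SFinite τ] :
    ∫⁻ x, ∫⁻ y, ENNReal.ofReal (f x - f (x + y)) ∂τ =
      ENNReal.ofReal (b - a) * ∫⁻ y, ENNReal.ofReal (-y) ∂τ := by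
  have hm := hf.measurable
  rw [lintegral_lintegral_swap (by fun_prop), ← lintegral_const_mul _ (by fun_prop)]
  refine lintegral_congr fun y => ?_
  rcases le_total y 0 with hy | hy
  · rw [← lintegral_translate_sub hf ha hb (neg_nonneg.2 hy),
      ← lintegral_add_right_eq_self _ (-y)]
    simp
  · rw [ENNReal.ofReal_of_nonpos (neg_nonpos.2 hy), mul_zero]
    refine (lintegral_congr fun x => ?_).trans lintegral_zero
    exact ENNReal.ofReal_of_nonpos (sub_nonpos.2 (hf (by linarith)))

lemma integrable_translate {f : ℝ → ℝ} (hm : Measurable f) {B : ℝ} (hB : ∀ x, |f x| ≤ B)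
    (τ : Measure ℝ) [IsFiniteMeasure τ] (x : ℝ) : Integrable (fun y => f (x + y)) τ :=
  Integrable.of_bound (hm.comp (measurable_const_add x)).aestronglyMeasurable B
    (Eventually.of_forall fun _ => hB _)

/-- The difference between a bounded function and its average over translates, split into the
positive and the negative parts of the increments. -/
lemma integral_translate_sub_eq {f : ℝ → ℝ} (hm : Measurable f) {B : ℝ} (hB : ∀ x, |f x| ≤ B)
    (τ : Measure ℝ) [IsProbabilityMeasure τ] (x : ℝ) :
    (∫ y, f (x + y) ∂τ) - f x = (∫⁻ y, ENNReal.ofReal (f (x + y) - f x) ∂τ).toReal -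
      (∫⁻ y, ENNReal.ofReal (f x - f (x + y)) ∂τ).toReal ∧
    ∫⁻ y, ENNReal.ofReal (f (x + y) - f x) ∂τ ≠ ∞ ∧
    ∫⁻ y, ENNReal.ofReal (f x - f (x + y)) ∂τ ≠ ∞ := by
  have hi : Integrable (fun y => f (x + y) - f x) τ :=
    (integrable_translate hm hB τ x).sub (integrable_const _)
  have h1 := integral_eq_lintegral_pos_part_sub_lintegral_neg_part hi
  rw [integral_sub (integrable_translate hm hB τ x) (integrable_const _)] at h1
  simp only [integral_const, probReal_univ, one_smul, neg_sub] at h1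
  refine ⟨h1, ?_, ?_⟩
  · exact (hi.lintegral_lt_top).ne
  · simpa using (hi.neg.lintegral_lt_top).ne

/-- A bounded monotone function that is subharmonic up to an error `k` bounds the
negative part of the drift. -/
lemma drift_le_of_subharmonic {f : ℝ → ℝ} (hf : Monotone f) {a b : ℝ}
    (ha : Tendsto f atBot (𝓝 a)) (hb : Tendsto f atTop (𝓝 b)) (τ : Measure ℝ)
    [IsProbabilityMeasure τ] {k : ℝ → ℝ} (hk : ∀ x, 0 ≤ k x)
    (hfk : ∀ x, f x ≤ (∫ y, f (x + y) ∂τ) + k x) :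
    ENNReal.ofReal (b - a) * ∫⁻ y, ENNReal.ofReal (-y) ∂τ ≤
      ENNReal.ofReal (b - a) * (∫⁻ y, ENNReal.ofReal y ∂τ) + ∫⁻ x, ENNReal.ofReal (k x) := by
  have hB := abs_le_of_monotone_of_tendsto hf ha hb
  have hm := hf.measurable
  rw [← lintegral_lintegral_increment_pos hf ha hb, ← lintegral_lintegral_increment_neg hf ha hb,
    ← lintegral_add_left (Measurable.lintegral_prod_right (by fun_prop))]
  refine lintegral_mono fun x => ?_
  obtain ⟨h1, h2, h3⟩ := integral_translate_sub_eq hm hB τ x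
  rw [← ENNReal.ofReal_toReal h2, ← ENNReal.ofReal_toReal h3,
    ← ENNReal.ofReal_add ENNReal.toReal_nonneg (hk x)]
  exact ENNReal.ofReal_le_ofReal (by linarith [hfk x])

/-- If a bounded monotone function is strictly superharmonic, then the drift is negative. -/
lemma drift_lt_of_superharmonic {f : ℝ → ℝ} (hf : Monotone f) {a b : ℝ} (hab : a < b)
    (ha : Tendsto f atBot (𝓝 a)) (hb : Tendsto f atTop (𝓝 b)) (τ : Measure ℝ)
    [IsProbabilityMeasure τ] (hτ : ∫⁻ y, ENNReal.ofReal y ∂τ ≠ ∞ ∨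
      ∫⁻ y, ENNReal.ofReal (-y) ∂τ ≠ ∞)
    (hlt : ∀ x, (∫ y, f (x + y) ∂τ) < f x) :
    ∫⁻ y, ENNReal.ofReal y ∂τ < ∫⁻ y, ENNReal.ofReal (-y) ∂τ := by
  have hB := abs_le_of_monotone_of_tendsto hf ha hb
  have hm := hf.measurable
  have hpt : ∀ x, ∫⁻ y, ENNReal.ofReal (f (x + y) - f x) ∂τ <
      ∫⁻ y, ENNReal.ofReal (f x - f (x + y)) ∂τ := by
    intro x
    obtain ⟨h1, h2, h3⟩ := integral_translate_sub_eq hm hB τ x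
    rw [← ENNReal.toReal_lt_toReal h2 h3]
    linarith [hlt x]
  have hpos : ENNReal.ofReal (b - a) ≠ 0 := by simpa using hab
  have hle : ∫⁻ y, ENNReal.ofReal y ∂τ ≤ ∫⁻ y, ENNReal.ofReal (-y) ∂τ := by
    rw [← ENNReal.mul_le_mul_iff_right hpos ENNReal.ofReal_ne_top,
      ← lintegral_lintegral_increment_pos hf ha hb, ← lintegral_lintegral_increment_neg hf ha hb]
    exact lintegral_mono fun x => (hpt x).le
  -- Strict comparison of integrals needs the smaller one to be finite. When only the negative part
  -- is known to be finite, the weak inequality passes this on to the positive part.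
  have hfin : ∫⁻ y, ENNReal.ofReal y ∂τ ≠ ∞ := by
    rcases hτ with h | h
    · exact h
    · exact ne_top_of_le_ne_top h hle
  rw [← ENNReal.mul_lt_mul_iff_right hpos ENNReal.ofReal_ne_top,
    ← lintegral_lintegral_increment_pos hf ha hb, ← lintegral_lintegral_increment_neg hf ha hb]
  refine lintegral_strict_mono (NeZero.ne _) ?_ ?_ ?_
  · exact (Measurable.lintegral_prod_right (by fun_prop)).aemeasurable
  · rw [lintegral_lintegral_increment_pos hf ha hb]
    exact ENNReal.mul_ne_top ENNReal.ofReal_ne_top hfin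
  · exact Eventually.of_forall hpt

/-! ### The fixed-point operator in logarithmic coordinates -/

/-- The function `(1 - e^{-s u}) / s` at `s = e^x`. -/
noncomputable def expQuot (x u : ℝ) : ℝ := Real.exp (-x) * (1 - Real.exp (-(Real.exp x * u)))

lemma exp_mul_expQuot (x u : ℝ) :
    Real.exp x * expQuot x u = 1 - Real.exp (-(Real.exp x * u)) := by
  rw [expQuot, ← mul_assoc, ← Real.exp_add]; simp

lemma expQuot_mono (x : ℝ) : Monotone (expQuot x) := by
  intro u v huv
  unfold expQuot
  gcongr

lemma expQuot_nonneg (x : ℝ) {u : ℝ} (hu : 0 ≤ u) : 0 ≤ expQuot x u := by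
  have : expQuot x 0 ≤ expQuot x u := expQuot_mono x hu
  simpa [expQuot] using this

lemma expQuot_le_exp_neg (x u : ℝ) : expQuot x u ≤ Real.exp (-x) := by
  unfold expQuot
  exact mul_le_of_le_one_right (Real.exp_pos _).le (by linarith [Real.exp_pos (-(Real.exp x * u))])

lemma expQuot_le (x u : ℝ) : expQuot x u ≤ u := by
  have h := exp_mul_expQuot x u
  have h2 := Real.add_one_le_exp (-(Real.exp x * u))
  have : Real.exp x * expQuot x u ≤ Real.exp x * u := by linarith
  exact le_of_mul_le_mul_left this (Real.exp_pos x)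

lemma expQuot_lt (x : ℝ) {u : ℝ} (hu : 0 < u) : expQuot x u < u := by
  have h := exp_mul_expQuot x u
  have h2 := Real.add_one_lt_exp (x := -(Real.exp x * u))
    (neg_ne_zero.2 (mul_pos (Real.exp_pos x) hu).ne')
  have : Real.exp x * expQuot x u < Real.exp x * u := by linarith
  exact lt_of_mul_lt_mul_left this (Real.exp_pos x).le

lemma sub_sq_le_one_sub_exp_neg {z : ℝ} (hz : 0 ≤ z) : z - z ^ 2 ≤ 1 - Real.exp (-z) := by
  rcases le_total z 1 with h | h
  · have := Real.abs_exp_sub_one_sub_id_le (x := -z) (by rwa [abs_neg, abs_of_nonneg hz])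
    have := (abs_le.1 this).2
    nlinarith
  · have : Real.exp (-z) ≤ 1 := Real.exp_le_one_iff.2 (by linarith)
    nlinarith

/-- With `expQuot_le` this shows that `expQuot x` differs from the identity by `O(e^x)` on bounded
sets of `u ≥ 0`. That gives the limits at `-∞` and an integrable bound for the defect on the
negative half-line. -/
lemma sub_le_expQuot (x : ℝ) {u : ℝ} (hu : 0 ≤ u) :
    u - Real.exp x * u ^ 2 ≤ expQuot x u := by
  have h := exp_mul_expQuot x u
  have h2 := sub_sq_le_one_sub_exp_neg (mul_nonneg (Real.exp_pos x).le hu)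
  have : Real.exp x * (u - Real.exp x * u ^ 2) ≤ Real.exp x * expQuot x u := by
    rw [h]; refine le_trans (le_of_eq ?_) h2; ring
  exact le_of_mul_le_mul_left this (Real.exp_pos x)

/-- Convexity of `exp`: the point `-(e^x u)` lies between `-(e^y u)` and `0` with weight `e^(x -
y)`, so the chord bound compares the two quotients. -/
lemma expQuot_anti_left (u : ℝ) : Antitone fun x => expQuot x u := by
  intro x y hxy
  have hr0 : 0 ≤ Real.exp (x - y) := (Real.exp_pos _).le
  have hr1 : Real.exp (x - y) ≤ 1 := Real.exp_le_one_iff.2 (by linarith)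
  have hc := convexOn_exp.2 (Set.mem_univ (-(Real.exp y * u))) (Set.mem_univ 0) hr0
    (sub_nonneg.2 hr1) (by ring)
  simp only [smul_eq_mul, mul_zero, add_zero, Real.exp_zero, mul_one] at hc
  have e : Real.exp (x - y) * -(Real.exp y * u) = -(Real.exp x * u) := by
    rw [mul_neg, ← mul_assoc, ← Real.exp_add]; simp
  rw [e] at hc
  have h1 := exp_mul_expQuot x u
  have h2 := exp_mul_expQuot y u
  have h3 : Real.exp x * expQuot y u ≤ Real.exp x * expQuot x u := by
    have : Real.exp x = Real.exp (x - y) * Real.exp y := by rw [← Real.exp_add]; simp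
    rw [h1]
    calc Real.exp x * expQuot y u = Real.exp (x - y) * (Real.exp y * expQuot y u) := by
          rw [this]; ring
      _ ≤ _ := by rw [h2]; linarith
  exact le_of_mul_le_mul_left h3 (Real.exp_pos x)

lemma expQuot_continuous (x : ℝ) : Continuous (expQuot x) := by unfold expQuot; fun_prop

/-- The operator whose fixed points are the transforms `(1 - φ(s)) / s`, at `s = e^x`, of the
Laplace transforms `φ` of solutions. -/
noncomputable def step (τ : Measure ℝ) (h : ℝ → ℝ) (x : ℝ) : ℝ := expQuot x (∫ y, h (x + y) ∂τ)

/-- Antitone functions with values in `[0, 1]`. -/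
structure IsProfile (h : ℝ → ℝ) : Prop where
  anti : Antitone h
  nonneg : ∀ x, 0 ≤ h x
  le_one : ∀ x, h x ≤ 1

namespace IsProfile

variable {h : ℝ → ℝ}

lemma abs_le (hh : IsProfile h) (x : ℝ) : |h x| ≤ 1 := by
  rw [abs_of_nonneg (hh.nonneg x)]; exact hh.le_one x

lemma integrable (hh : IsProfile h) (τ : Measure ℝ) [IsProbabilityMeasure τ] (x : ℝ) :
    Integrable (fun y => h (x + y)) τ :=
  integrable_translate hh.anti.measurable hh.abs_le τ x

lemma average (hh : IsProfile h) (τ : Measure ℝ) [IsProbabilityMeasure τ] :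
    IsProfile fun x => ∫ y, h (x + y) ∂τ where
  anti x y hxy := integral_mono (hh.integrable τ _) (hh.integrable τ _)
    fun z => hh.anti (by linarith)
  nonneg _ := integral_nonneg fun y => hh.nonneg _
  le_one x := by
    have := integral_mono (hh.integrable τ x) (integrable_const 1) fun y => hh.le_one (x + y)
    simpa using this

lemma step (hh : IsProfile h) (τ : Measure ℝ) [IsProbabilityMeasure τ] :
    IsProfile (step τ h) where
  anti _ y hxy := ((expQuot_mono y) ((hh.average τ).anti hxy)).trans
    (expQuot_anti_left _ hxy)
  nonneg x := expQuot_nonneg x ((hh.average τ).nonneg x)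
  le_one x := (expQuot_le _ _).trans ((hh.average τ).le_one x)

end IsProfile

lemma step_mono {h g : ℝ → ℝ} (hh : IsProfile h) (hg : IsProfile g) (τ : Measure ℝ)
    [IsProbabilityMeasure τ] (hle : ∀ x, h x ≤ g x) (x : ℝ) : step τ h x ≤ step τ g x :=
  expQuot_mono x (integral_mono (hh.integrable τ x) (hg.integrable τ x) fun y => hle (x + y))

/-- The iterates of the operator started at the transform of the point mass at `1`. -/
noncomputable def iter (τ : Measure ℝ) (n : ℕ) : ℝ → ℝ := (step τ)^[n] fun x => expQuot x 1

lemma iter_zero (τ : Measure ℝ) (x : ℝ) : iter τ 0 x = expQuot x 1 := rfl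

lemma iter_succ (τ : Measure ℝ) (n : ℕ) : iter τ (n + 1) = step τ (iter τ n) := by
  simp only [iter, Function.iterate_succ_apply']

/-! ### Monotone iteration and its limit -/

section iter

variable (τ : Measure ℝ) [IsProbabilityMeasure τ]

lemma isProfile_iter (n : ℕ) : IsProfile (iter τ n) := by
  induction n with
  | zero =>
    exact ⟨expQuot_anti_left 1, fun x => expQuot_nonneg x zero_le_one,
      fun x => expQuot_le x 1⟩
  | succ n ih => rw [iter_succ]; exact ih.step τ

lemma iter_succ_le (n : ℕ) (x : ℝ) : iter τ (n + 1) x ≤ iter τ n x := by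
  induction n generalizing x with
  | zero =>
    rw [iter_succ]
    -- The start is `expQuot x 1`, and an average of a profile is at most `1`.
    exact expQuot_mono x (((isProfile_iter τ 0).average τ).le_one x)
  | succ n ih =>
    rw [iter_succ, iter_succ]
    exact step_mono (iter_succ τ n ▸ isProfile_iter τ (n + 1)) (isProfile_iter τ n) τ
      (by rw [← iter_succ]; exact ih) x

lemma iter_anti (x : ℝ) : Antitone fun n => iter τ n x :=
  antitone_nat_of_succ_le fun n => iter_succ_le τ n x

lemma iter_le_exp_neg (n : ℕ) (x : ℝ) : iter τ n x ≤ Real.exp (-x) :=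
  (iter_anti τ x (Nat.zero_le n)).trans (expQuot_le_exp_neg x 1)

/-- The decreasing limit of the iterates. -/
noncomputable def limitProfile (τ : Measure ℝ) (x : ℝ) : ℝ := ⨅ n, iter τ n x

lemma tendsto_iter (x : ℝ) : Tendsto (fun n => iter τ n x) atTop (𝓝 (limitProfile τ x)) :=
  tendsto_atTop_ciInf (iter_anti τ x) ⟨0, by rintro _ ⟨n, rfl⟩; exact (isProfile_iter τ n).nonneg x⟩

lemma isProfile_limitProfile : IsProfile (limitProfile τ) where
  anti x y hxy := le_of_tendsto_of_tendsto' (tendsto_iter τ y) (tendsto_iter τ x)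
    fun n => (isProfile_iter τ n).anti hxy
  nonneg x := ge_of_tendsto' (tendsto_iter τ x) fun n => (isProfile_iter τ n).nonneg x
  le_one x := le_of_tendsto' (tendsto_iter τ x) fun n => (isProfile_iter τ n).le_one x

lemma tendsto_average_iter (x : ℝ) : Tendsto (fun n => ∫ y, iter τ n (x + y) ∂τ) atTop
    (𝓝 (∫ y, limitProfile τ (x + y) ∂τ)) := by
  refine tendsto_integral_of_dominated_convergence (fun _ => 1)
    (fun n => ((isProfile_iter τ n).integrable τ x).1) (integrable_const _)
    (fun n => Eventually.of_forall fun y => ?_) (Eventually.of_forall fun y => tendsto_iter τ _)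
  exact (isProfile_iter τ n).abs_le _

lemma step_limitProfile : step τ (limitProfile τ) = limitProfile τ := by
  funext x
  refine tendsto_nhds_unique ?_ ((tendsto_iter τ x).comp (tendsto_add_atTop_nat 1))
  have := ((expQuot_continuous x).tendsto _).comp (tendsto_average_iter τ x)
  refine this.congr fun n => ?_
  simp only [Function.comp, iter_succ, step]

lemma tendsto_expQuot_atBot {H : ℝ → ℝ} (h0 : ∀ x, 0 ≤ H x) (h1 : ∀ x, H x ≤ 1)
    (hH : Tendsto H atBot (𝓝 1)) : Tendsto (fun x => expQuot x (H x)) atBot (𝓝 1) := by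
  refine tendsto_of_tendsto_of_tendsto_of_le_of_le (g := fun x => H x - Real.exp x) ?_ hH
    (fun x => ?_) fun x => expQuot_le _ _
  · simpa using hH.sub Real.tendsto_exp_atBot
  · refine le_trans ?_ (sub_le_expQuot x (h0 x))
    have := mul_le_mul_of_nonneg_left (pow_le_one₀ (n := 2) (h0 x) (h1 x)) (Real.exp_pos x).le
    simp only
    linarith

/-- With `tendsto_iter_atTop`, every iterate drops by exactly `1` across the line, so the factor `b
- a` in the drift inequality is `1` for all `n`. Pointwise convergence alone would not give this for
the limit. -/
lemma tendsto_iter_atBot (n : ℕ) : Tendsto (iter τ n) atBot (𝓝 1) := by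
  induction n with
  | zero => exact tendsto_expQuot_atBot (fun _ => zero_le_one) (fun _ => le_rfl) tendsto_const_nhds
  | succ n ih =>
    rw [iter_succ]
    have hp := (isProfile_iter τ n)
    refine tendsto_expQuot_atBot (hp.average τ).nonneg (hp.average τ).le_one ?_
    have : Tendsto (fun x => ∫ y, iter τ n (x + y) ∂τ) atBot (𝓝 (∫ _, (1 : ℝ) ∂τ)) := by
      refine tendsto_integral_filter_of_dominated_convergence (fun _ => 1)
        (Eventually.of_forall fun x => (hp.integrable τ x).1)
        (Eventually.of_forall fun x => Eventually.of_forall fun y => hp.abs_le _)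
        (integrable_const _) (Eventually.of_forall fun y => ?_)
      exact ih.comp (tendsto_atBot_add_const_right _ y tendsto_id)
    simpa using this

lemma tendsto_iter_atTop (n : ℕ) : Tendsto (iter τ n) atTop (𝓝 0) :=
  squeeze_zero (isProfile_iter τ n).nonneg (iter_le_exp_neg τ n)
    (Real.tendsto_exp_neg_atTop_nhds_zero)

/-- The initial profile is at most `min 1 (e^(-z))`, so its integral over `z > y` is at most `y⁻ +
1`. Averaging over `y` is where the negative part must be integrable. -/
lemma lintegral_average_exp_neg_ne_top (hτ : ∫⁻ y, ENNReal.ofReal (-y) ∂τ ≠ ∞) :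
    ∫⁻ x in Set.Ioi (0 : ℝ), ENNReal.ofReal (∫ y, iter τ 0 (x + y) ∂τ) ≠ ∞ := by
  have hp := isProfile_iter τ 0
  have hm := hp.anti.measurable
  have hexp : ∫⁻ z in Set.Ioi (0 : ℝ), ENNReal.ofReal (Real.exp (-z)) = 1 := by
    rw [← ofReal_integral_eq_lintegral_ofReal (integrableOn_exp_neg_Ioi 0)
      (Eventually.of_forall fun z => (Real.exp_pos _).le), integral_exp_neg_Ioi_zero]
    simp
  have key : ∀ y : ℝ, ∫⁻ x in Set.Ioi (0 : ℝ), ENNReal.ofReal (iter τ 0 (x + y)) ≤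
      ENNReal.ofReal (-y) + 1 := by
    intro y
    have e1 : ∫⁻ x in Set.Ioi (0 : ℝ), ENNReal.ofReal (iter τ 0 (x + y)) =
        ∫⁻ z in Set.Ioi y, ENNReal.ofReal (iter τ 0 z) := by
      rw [← lintegral_indicator measurableSet_Ioi, ← lintegral_indicator measurableSet_Ioi,
        ← lintegral_add_right_eq_self
          ((Set.Ioi y).indicator fun z => ENNReal.ofReal (iter τ 0 z)) y]
      refine lintegral_congr fun x => ?_
      simp [Set.indicator]
    rw [e1]
    calc ∫⁻ z in Set.Ioi y, ENNReal.ofReal (iter τ 0 z)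
        ≤ ∫⁻ z in Set.Ioc y 0 ∪ Set.Ioi 0, ENNReal.ofReal (iter τ 0 z) := by
          refine lintegral_mono_set fun z hz => ?_
          rcases le_or_gt z 0 with h | h
          · exact Or.inl ⟨hz, h⟩
          · exact Or.inr h
      _ ≤ (∫⁻ z in Set.Ioc y 0, ENNReal.ofReal (iter τ 0 z)) +
          ∫⁻ z in Set.Ioi 0, ENNReal.ofReal (iter τ 0 z) := lintegral_union_le _ _ _
      _ ≤ (∫⁻ _ in Set.Ioc y 0, 1) + ∫⁻ z in Set.Ioi 0, ENNReal.ofReal (Real.exp (-z)) := by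
          refine add_le_add (lintegral_mono fun z => ?_) (lintegral_mono fun z => ?_)
          · exact ENNReal.ofReal_le_one.2 (hp.le_one z)
          · exact ENNReal.ofReal_le_ofReal (iter_le_exp_neg τ 0 z)
      _ = ENNReal.ofReal (-y) + 1 := by rw [hexp]; simp
  have e2 : ∀ x, ENNReal.ofReal (∫ y, iter τ 0 (x + y) ∂τ) =
      ∫⁻ y, ENNReal.ofReal (iter τ 0 (x + y)) ∂τ := fun x =>
    ofReal_integral_eq_lintegral_ofReal (hp.integrable τ x)
      (Eventually.of_forall fun y => hp.nonneg _)
  simp_rw [e2]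
  rw [lintegral_lintegral_swap (by fun_prop)]
  refine ne_top_of_le_ne_top ?_ (lintegral_mono key)
  rw [lintegral_add_right _ measurable_const]
  simpa using hτ

lemma limitProfile_ne_zero_of_finite_drift (hneg : ∫⁻ y, ENNReal.ofReal (-y) ∂τ ≠ ∞)
    (hdrift : ∫⁻ y, ENNReal.ofReal y ∂τ < ∫⁻ y, ENNReal.ofReal (-y) ∂τ) :
    ∃ x, limitProfile τ x ≠ 0 := by
  by_contra! hzero
  -- `k n` is the amount by which `expQuot` falls short of the identity. Since the iterates decrease
  -- in `n`, it also bounds the failure of `-iter τ n` to be subharmonic.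
  set k : ℕ → ℝ → ℝ := fun n x => (∫ y, iter τ n (x + y) ∂τ) - iter τ (n + 1) x with hk
  have hp := isProfile_iter τ
  have hk0 : ∀ n x, 0 ≤ k n x := fun n x => by
    simp only [hk, iter_succ, step]
    exact sub_nonneg.2 (expQuot_le _ _)
  have hineq : ∀ n, ∫⁻ y, ENNReal.ofReal (-y) ∂τ ≤
      (∫⁻ y, ENNReal.ofReal y ∂τ) + ∫⁻ x, ENNReal.ofReal (k n x) := by
    intro n
    have := drift_le_of_subharmonic (f := fun x => -iter τ n x) (hp n).anti.neg
      (tendsto_iter_atBot τ n).neg (tendsto_iter_atTop τ n).neg τ (hk0 n) (fun x => by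
        simp only [hk, integral_neg]
        linarith [iter_succ_le τ n x])
    simpa using this
  have hkm : ∀ n, Measurable (k n) := fun n =>
    ((hp n).average τ).anti.measurable.sub (hp (n + 1)).anti.measurable
  -- On the left `k n` is at most `e^x`, by the second-order bound; on the right it is at most the
  -- average of the initial profile, because the iterates decrease.
  set bd : ℝ → ℝ≥0∞ := fun x => (Set.Iic (0 : ℝ)).indicator (fun x => ENNReal.ofReal (Real.exp x)) x
    + (Set.Ioi (0 : ℝ)).indicator (fun x => ENNReal.ofReal (∫ y, iter τ 0 (x + y) ∂τ)) x with hbd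
  have hlim : Tendsto (fun n => ∫⁻ x, ENNReal.ofReal (k n x)) atTop (𝓝 (∫⁻ _ : ℝ, 0)) := by
    refine tendsto_lintegral_of_dominated_convergence bd (fun n => (hkm n).ennreal_ofReal)
      (fun n => Eventually.of_forall fun x => ?_) ?_ (Eventually.of_forall fun x => ?_)
    · rcases le_or_gt x 0 with hx | hx
      · simp only [hbd, Set.indicator_of_mem (Set.mem_Iic.2 hx),
          Set.indicator_of_notMem (Set.notMem_Ioi.2 hx), add_zero]
        refine ENNReal.ofReal_le_ofReal ?_
        simp only [hk, iter_succ, step]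
        have h0 := ((hp n).average τ).nonneg x
        have h1 := ((hp n).average τ).le_one x
        have := sub_le_expQuot x h0
        have := mul_le_mul_of_nonneg_left (pow_le_one₀ (n := 2) h0 h1) (Real.exp_pos x).le
        linarith
      · simp only [hbd, Set.indicator_of_notMem (Set.notMem_Iic.2 hx),
          Set.indicator_of_mem (Set.mem_Ioi.2 hx), zero_add]
        refine ENNReal.ofReal_le_ofReal ?_
        have h1 := (hp (n + 1)).nonneg x
        have h2 : ∫ y, iter τ n (x + y) ∂τ ≤ ∫ y, iter τ 0 (x + y) ∂τ :=
          integral_mono ((hp n).integrable τ x) ((hp 0).integrable τ x)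
            fun y => iter_anti τ (x + y) (Nat.zero_le n)
        simp only [hk]
        linarith
    · rw [hbd, lintegral_add_left
        (Measurable.indicator (by fun_prop) measurableSet_Iic),
        lintegral_indicator measurableSet_Iic, lintegral_indicator measurableSet_Ioi]
      refine ENNReal.add_ne_top.2 ⟨?_, lintegral_average_exp_neg_ne_top τ hneg⟩
      rw [← ofReal_integral_eq_lintegral_ofReal (integrableOn_exp_Iic 0)
        (Eventually.of_forall fun z => (Real.exp_pos _).le)]
      exact ENNReal.ofReal_ne_top
    · have h1 := (tendsto_average_iter τ x).sub ((tendsto_iter τ x).comp (tendsto_add_atTop_nat 1))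
      simp only [hzero, integral_zero, sub_zero] at h1
      have h2 := ENNReal.tendsto_ofReal h1
      rw [ENNReal.ofReal_zero] at h2
      exact h2
  have hfin := ge_of_tendsto' (tendsto_const_nhds.add hlim) hineq
  simp only [lintegral_zero, add_zero] at hfin
  exact absurd hfin (not_le.2 hdrift)

end iter

/-! ### Truncating the drift from below -/

lemma iter_le_of_map_max (τ : Measure ℝ) [IsProbabilityMeasure τ] (L : ℝ) (n : ℕ) (x : ℝ) :
    iter (τ.map fun y => max y L) n x ≤ iter τ n x := by
  have hmax : Measurable fun y : ℝ => max y L := by fun_prop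
  have : IsProbabilityMeasure (τ.map fun y => max y L) :=
    Measure.isProbabilityMeasure_map hmax.aemeasurable
  induction n generalizing x with
  | zero => rfl
  | succ n ih =>
    have hp := isProfile_iter (τ.map fun y => max y L) n
    have hq := isProfile_iter τ n
    rw [iter_succ, iter_succ]
    refine expQuot_mono x ?_
    rw [integral_map (f := fun y => iter (τ.map fun y => max y L) n (x + y)) hmax.aemeasurable
      (hp.anti.measurable.comp (measurable_const_add x)).aestronglyMeasurable]
    refine integral_mono (Integrable.of_bound
      (hp.anti.measurable.comp (hmax.const_add x)).aestronglyMeasurable 1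
      (Eventually.of_forall fun y => hp.abs_le _)) (hq.integrable τ x) fun y => ?_
    -- Replacing `y` by the larger `max y L` lowers an antitone profile, so a non-zero limit for the
    -- truncated law gives one for `τ`.
    exact (ih _).trans (hq.anti (by simp))

lemma exists_truncation_drift (τ : Measure ℝ)
    (hdrift : ∫⁻ y, ENNReal.ofReal y ∂τ < ∫⁻ y, ENNReal.ofReal (-y) ∂τ) :
    ∃ N : ℕ, ∫⁻ y, ENNReal.ofReal y ∂τ < ∫⁻ y, ENNReal.ofReal (min (-y) N) ∂τ := by
  have hmono : Monotone fun (N : ℕ) (y : ℝ) => ENNReal.ofReal (min (-y) N) := by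
    intro M N h y
    refine ENNReal.ofReal_le_ofReal (min_le_min_left _ ?_)
    exact_mod_cast h
  have hlim : Tendsto (fun N : ℕ => ∫⁻ y, ENNReal.ofReal (min (-y) N) ∂τ) atTop
      (𝓝 (∫⁻ y, ENNReal.ofReal (-y) ∂τ)) := by
    refine lintegral_tendsto_of_tendsto_of_monotone (fun N => by fun_prop)
      (Eventually.of_forall fun y M N h => hmono h y) (Eventually.of_forall fun y => ?_)
    refine tendsto_const_nhds.congr' ?_
    obtain ⟨M, hM⟩ := exists_nat_ge (-y)
    filter_upwards [eventually_ge_atTop M] with N hN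
    rw [min_eq_left (hM.trans (by exact_mod_cast hN))]
  exact (hlim.eventually (lt_mem_nhds hdrift)).exists

/-- If the drift is negative, then the iterates do not degenerate. -/
lemma limitProfile_ne_zero (τ : Measure ℝ) [IsProbabilityMeasure τ]
    (hdrift : ∫⁻ y, ENNReal.ofReal y ∂τ < ∫⁻ y, ENNReal.ofReal (-y) ∂τ) :
    ∃ x, limitProfile τ x ≠ 0 := by
  obtain ⟨N, hN⟩ := exists_truncation_drift τ hdrift
  have hmax : Measurable fun y : ℝ => max y (-(N : ℝ)) := by fun_prop
  have : IsProbabilityMeasure (τ.map fun y => max y (-(N : ℝ))) :=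
    Measure.isProbabilityMeasure_map hmax.aemeasurable
  have e1 : ∫⁻ y, ENNReal.ofReal y ∂(τ.map fun y => max y (-(N : ℝ))) =
      ∫⁻ y, ENNReal.ofReal y ∂τ := by
    rw [lintegral_map (by fun_prop) hmax]
    refine lintegral_congr fun y => ?_
    rcases le_total 0 y with hy | hy
    · rw [max_eq_left (by linarith [N.cast_nonneg (α := ℝ)])]
    · rw [ENNReal.ofReal_of_nonpos hy, ENNReal.ofReal_of_nonpos]
      simpa using hy
  have e2 : ∫⁻ y, ENNReal.ofReal (-y) ∂(τ.map fun y => max y (-(N : ℝ))) =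
      ∫⁻ y, ENNReal.ofReal (min (-y) N) ∂τ := by
    rw [lintegral_map (by fun_prop) hmax]
    refine lintegral_congr fun y => ?_
    rw [← min_neg_neg, neg_neg]
  obtain ⟨x, hx⟩ := limitProfile_ne_zero_of_finite_drift (τ.map fun y => max y (-(N : ℝ)))
    (by
      rw [e2]
      refine ne_top_of_le_ne_top (b := ENNReal.ofReal N) ENNReal.ofReal_ne_top ?_
      refine (lintegral_mono fun y => ENNReal.ofReal_le_ofReal (min_le_right _ _)).trans ?_
      simp)
    (by rw [e1, e2]; exact hN)
  refine ⟨x, ne_of_gt (lt_of_lt_of_le (((isProfile_limitProfile _).nonneg x).lt_of_ne' hx) ?_)⟩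
  exact le_of_tendsto_of_tendsto' (tendsto_iter _ x) (tendsto_iter _ x)
    fun n => iter_le_of_map_max τ _ n x

/-! ### Laplace transforms of measures on the half-line -/

/-- The Laplace transform of a measure. -/
noncomputable def laplace (μ : Measure ℝ) (s : ℝ) : ℝ := ∫ x, Real.exp (-(s * x)) ∂μ

lemma ae_nonneg_of_measure_Iio {μ : Measure ℝ} (hμ : μ (Set.Iio 0) = 0) : ∀ᵐ x ∂μ, 0 ≤ x := by
  rw [ae_iff]
  simpa [Set.Iio] using hμ

lemma measure_Iio_of_ae_nonneg {μ : Measure ℝ} (hμ : ∀ᵐ x ∂μ, 0 ≤ x) : μ (Set.Iio 0) = 0 := by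
  rw [ae_iff] at hμ
  simpa [Set.Iio] using hμ

lemma exp_neg_mul_mem {s x : ℝ} (hs : 0 ≤ s) (hx : 0 ≤ x) : ‖Real.exp (-(s * x))‖ ≤ 1 := by
  rw [Real.norm_eq_abs, Real.abs_exp]
  exact Real.exp_le_one_iff.2 (neg_nonpos.2 (mul_nonneg hs hx))

lemma integrable_exp_neg_mul {μ : Measure ℝ} [IsFiniteMeasure μ] (hμ : ∀ᵐ x ∂μ, 0 ≤ x) {s : ℝ}
    (hs : 0 ≤ s) : Integrable (fun x => Real.exp (-(s * x))) μ :=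
  Integrable.of_bound (by fun_prop) 1 (hμ.mono fun x hx => exp_neg_mul_mem hs hx)

lemma laplace_nonneg (μ : Measure ℝ) (s : ℝ) : 0 ≤ laplace μ s :=
  integral_nonneg fun _ => (Real.exp_pos _).le

lemma laplace_le_one {μ : Measure ℝ} [IsProbabilityMeasure μ] (hμ : ∀ᵐ x ∂μ, 0 ≤ x) {s : ℝ}
    (hs : 0 ≤ s) : laplace μ s ≤ 1 := by
  have : ∫ x, Real.exp (-(s * x)) ∂μ ≤ ∫ _, (1 : ℝ) ∂μ :=
    integral_mono_ae (integrable_exp_neg_mul hμ hs) (integrable_const _)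
      (hμ.mono fun x hx => (le_abs_self _).trans (exp_neg_mul_mem hs hx))
  simpa [laplace] using this

lemma Iio_subset_integrableExpSet {μ : Measure ℝ} [IsFiniteMeasure μ] (hμ : ∀ᵐ x ∂μ, 0 ≤ x) :
    Set.Iio 0 ⊆ interior (ProbabilityTheory.integrableExpSet id μ) := by
  refine interior_maximal (fun t ht => ?_) isOpen_Iio
  have := integrable_exp_neg_mul hμ (s := -t) (by simpa using (le_of_lt ht))
  simpa [ProbabilityTheory.integrableExpSet] using this

/-- A finite measure on the half-line is determined by its Laplace transform. -/
lemma ext_of_laplace {μ ν : Measure ℝ} [IsFiniteMeasure μ] [IsFiniteMeasure ν]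
    (hμ : ∀ᵐ x ∂μ, 0 ≤ x) (hν : ∀ᵐ x ∂ν, 0 ≤ x) (h : ∀ s, 0 < s → laplace μ s = laplace ν s) :
    μ = ν := by
  have hanal : ∀ (κ : Measure ℝ) [IsFiniteMeasure κ], (∀ᵐ x ∂κ, 0 ≤ x) →
      AnalyticOnNhd ℂ (ProbabilityTheory.complexMGF id κ) {z | z.re < 0} := by
    intro κ _ hκ z hz
    exact ProbabilityTheory.analyticAt_complexMGF (Iio_subset_integrableExpSet hκ hz)
  have hconv : Convex ℝ {z : ℂ | z.re < 0} := convex_halfSpace_re_lt 0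
  have hhalf : Set.EqOn (ProbabilityTheory.complexMGF id μ) (ProbabilityTheory.complexMGF id ν)
      {z | z.re < 0} := by
    refine (hanal μ hμ).eqOn_of_preconnected_of_frequently_eq (hanal ν hν)
      hconv.isPreconnected (z₀ := -1) (by simp) ?_
    -- Equality at real points accumulating at `-1` suffices for the identity theorem on the left
    -- half-plane.
    have hseq : Tendsto (fun n : ℕ => ((-1 - 1 / ((n : ℝ) + 1) : ℝ) : ℂ)) atTop (𝓝[≠] (-1)) := by
      refine tendsto_nhdsWithin_iff.2 ⟨?_, Eventually.of_forall fun n => ?_⟩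
      · have := (tendsto_const_nhds (x := (-1 : ℝ))).sub
          (tendsto_one_div_add_atTop_nhds_zero_nat (𝕜 := ℝ))
        have := (Complex.continuous_ofReal.tendsto _).comp this
        simpa [Function.comp_def] using this
      · have : (0 : ℝ) < 1 / ((n : ℝ) + 1) := by positivity
        intro hc
        have := congrArg Complex.re hc
        simp only [Complex.ofReal_re, Complex.neg_re, Complex.one_re] at this
        linarith
    refine hseq.frequently (Frequently.of_forall fun n => ?_)
    have hpos : (0 : ℝ) < 1 / ((n : ℝ) + 1) := by positivity
    have := h (1 + 1 / ((n : ℝ) + 1)) (by positivity)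
    rw [ProbabilityTheory.complexMGF_ofReal, ProbabilityTheory.complexMGF_ofReal]
    congr 1
    simp only [laplace] at this
    simp only [ProbabilityTheory.mgf, id]
    convert this using 4 <;> ring
  -- Approaching the imaginary axis from the left recovers the characteristic function, which may
  -- lie on the boundary of the domain of analyticity.
  have hlim : ∀ (κ : Measure ℝ) [IsFiniteMeasure κ], (∀ᵐ x ∂κ, 0 ≤ x) → ∀ t : ℝ,
      Tendsto (fun n : ℕ => ProbabilityTheory.complexMGF id κ
        (((-(1 / ((n : ℝ) + 1)) : ℝ) : ℂ) + t * Complex.I)) atTop (𝓝 (charFun κ t)) := by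
    intro κ _ hκ t
    rw [← ProbabilityTheory.complexMGF_id_mul_I]
    refine tendsto_integral_of_dominated_convergence (fun _ => 1) (fun n => by fun_prop)
      (integrable_const _) (fun n => hκ.mono fun x hx => ?_) (Eventually.of_forall fun x => ?_)
    · rw [Complex.norm_exp]
      have : (0 : ℝ) < 1 / ((n : ℝ) + 1) := by positivity
      simp only [id, Complex.mul_re, Complex.add_re, Complex.ofReal_re, Complex.I_re,
        Complex.add_im, Complex.ofReal_im, Complex.mul_im, Complex.I_im]
      refine Real.exp_le_one_iff.2 ?_
      nlinarith
    · have h1 : Tendsto (fun n : ℕ => ((-(1 / ((n : ℝ) + 1)) : ℝ) : ℂ)) atTop (𝓝 0) := by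
        have := (tendsto_one_div_add_atTop_nhds_zero_nat (𝕜 := ℝ)).neg
        have := (Complex.continuous_ofReal.tendsto _).comp this
        simpa [Function.comp_def] using this
      have h2 := ((h1.add_const ((t : ℂ) * Complex.I)).mul_const ((id x : ℝ) : ℂ)).cexp
      simpa using h2
  refine Measure.ext_of_charFun (funext fun t => ?_)
  refine tendsto_nhds_unique (hlim μ hμ t) ((hlim ν hν t).congr fun n => ?_)
  have hpos : (0 : ℝ) < 1 / ((n : ℝ) + 1) := by positivity
  have hz : (((-(1 / ((n : ℝ) + 1)) : ℝ) : ℂ) + t * Complex.I).re < 0 := by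
    rw [Complex.add_re, Complex.ofReal_re, Complex.re_ofReal_mul, Complex.I_re]
    linarith
  exact (hhalf hz).symm

/-- `φ` agrees on `(0, ∞)` with the Laplace transform of a probability measure on `[0, ∞)`. -/
def IsLaplaceTransform (φ : ℝ → ℝ) : Prop :=
  ∃ μ : Measure ℝ, IsProbabilityMeasure μ ∧ (∀ᵐ x ∂μ, 0 ≤ x) ∧ ∀ s, 0 < s → laplace μ s = φ s

/-- A Markov bound: for `x > 1/s` one has `1 - e^(-s x) ≥ 1 - e^(-1) ≥ 1/2`, whence the factor `2`.
It supplies tightness. -/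
lemma measure_lt_le_of_laplace {μ : Measure ℝ} [IsProbabilityMeasure μ] (hμ : ∀ᵐ x ∂μ, 0 ≤ x)
    {s : ℝ} (hs : 0 < s) :
    μ (Set.Ioi s⁻¹) ≤ ENNReal.ofReal (2 * (1 - laplace μ s)) := by
  have hi : Integrable (fun x => 2 * (1 - Real.exp (-(s * x)))) μ :=
    ((integrable_const _).sub (integrable_exp_neg_mul hμ hs.le)).const_mul 2
  have e : 2 * (1 - laplace μ s) = ∫ x, 2 * (1 - Real.exp (-(s * x))) ∂μ := by
    rw [integral_const_mul, integral_sub (integrable_const _) (integrable_exp_neg_mul hμ hs.le)]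
    simp [laplace]
  have h0 : 0 ≤ᵐ[μ] fun x => 2 * (1 - Real.exp (-(s * x))) := hμ.mono fun x hx => by
    have := (le_abs_self _).trans (exp_neg_mul_mem hs.le hx)
    simp only [Pi.zero_apply]; linarith
  rw [e, ofReal_integral_eq_lintegral_ofReal hi h0,
    ← lintegral_indicator_one measurableSet_Ioi]
  refine lintegral_mono fun x => ?_
  by_cases hx : s⁻¹ < x
  · rw [Set.indicator_of_mem (by exact hx)]
    simp only [Pi.one_apply]
    rw [← ENNReal.ofReal_one]
    refine ENNReal.ofReal_le_ofReal ?_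
    have h1 : 1 ≤ s * x := by
      have := mul_le_mul_of_nonneg_left hx.le hs.le
      rwa [mul_inv_cancel₀ hs.ne'] at this
    have h2 : Real.exp (-(s * x)) ≤ Real.exp (-1) := Real.exp_le_exp.2 (by linarith)
    have h3 := Real.exp_neg_one_lt_d9
    linarith
  · rw [Set.indicator_of_notMem (by exact hx)]
    exact zero_le

/-- Pointwise limits of Laplace transforms with uniformly bounded means are Laplace transforms. -/
lemma IsLaplaceTransform.of_tendsto {φ : ℕ → ℝ → ℝ} {ψ : ℝ → ℝ}
    (hφ : ∀ n, IsLaplaceTransform (φ n)) (hb : ∀ n s, 0 < s → 1 - φ n s ≤ s)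
    (hlim : ∀ s, 0 < s → Tendsto (fun n => φ n s) atTop (𝓝 (ψ s))) : IsLaplaceTransform ψ := by
  choose μ hprob hpos hlap using hφ
  set p : ℕ → ProbabilityMeasure ℝ := fun n => ⟨μ n, hprob n⟩ with hp
  -- Taking `s = 1/r`, the bound `1 - φ n s ≤ s` gives tails of at most `2/r` uniformly in `n`;
  -- Prokhorov's theorem then applies.
  have htight : IsTightMeasureSet {((κ : ProbabilityMeasure ℝ) : Measure ℝ) | κ ∈ Set.range p} := by
    refine isTightMeasureSet_of_tendsto_measure_norm_gt ?_
    have h0 : Tendsto (fun r : ℝ => ENNReal.ofReal (2 * r⁻¹)) atTop (𝓝 0) := by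
      have := ENNReal.tendsto_ofReal (tendsto_inv_atTop_zero.const_mul (2 : ℝ))
      simpa using this
    refine tendsto_of_tendsto_of_tendsto_of_le_of_le' tendsto_const_nhds h0
      (Eventually.of_forall fun _ => zero_le) ?_
    filter_upwards [eventually_gt_atTop 0] with r hr
    refine iSup₂_le ?_
    rintro _ ⟨_, ⟨n, rfl⟩, rfl⟩
    have h1 := measure_lt_le_of_laplace (hpos n) (inv_pos.2 hr)
    rw [inv_inv] at h1
    have h2 : μ n {x | r < ‖x‖} ≤ μ n (Set.Ioi r) := by
      refine measure_mono_ae ((hpos n).mono fun x hx hrx => ?_)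
      have : r < ‖x‖ := hrx
      rwa [Real.norm_of_nonneg hx] at this
    refine h2.trans (h1.trans (ENNReal.ofReal_le_ofReal ?_))
    rw [hlap n _ (inv_pos.2 hr)]
    linarith [hb n _ (inv_pos.2 hr)]
  have hcomp := isCompact_closure_of_isTightMeasureSet htight
  obtain ⟨q, -, g, hg, hq⟩ := hcomp.tendsto_subseq (x := p) fun n => subset_closure ⟨n, rfl⟩
  rw [ProbabilityMeasure.tendsto_iff_forall_integral_tendsto] at hq
  have hqpos : ∀ᵐ x ∂(q : Measure ℝ), 0 ≤ x := by
    -- This test function vanishes exactly on `[0, ∞)`, so its integral detects any mass on the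
    -- negative axis.
    let f : BoundedContinuousFunction ℝ ℝ :=
      BoundedContinuousFunction.ofNormedAddCommGroup (fun x : ℝ => min (max (-x) 0) 1)
        (by fun_prop) 1 (fun x => by
          rw [Real.norm_of_nonneg (le_min (le_max_right _ _) zero_le_one)]
          exact min_le_right _ _)
    have h1 := hq f
    have h2 : ∀ n, ∫ x, f x ∂((p ∘ g) n : Measure ℝ) = 0 := by
      intro n
      refine integral_eq_zero_of_ae ((hpos (g n)).mono fun x hx => ?_)
      simp only [f, BoundedContinuousFunction.coe_ofNormedAddCommGroup, Pi.zero_apply]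
      rw [max_eq_right (by linarith), min_eq_left zero_le_one]
    simp only [h2] at h1
    have h3 := tendsto_nhds_unique h1 tendsto_const_nhds
    have h4 := (integral_eq_zero_iff_of_nonneg (fun x => by
      simp only [f, BoundedContinuousFunction.coe_ofNormedAddCommGroup, Pi.zero_apply]
      exact le_min (le_max_right _ _) zero_le_one) (f.integrable _)).1 h3
    filter_upwards [h4] with x hx
    simp only [f, BoundedContinuousFunction.coe_ofNormedAddCommGroup, Pi.zero_apply] at hx
    by_contra! hneg
    have : 0 < min (max (-x) 0) 1 := lt_min (lt_max_of_lt_left (by linarith)) one_pos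
    linarith
  refine ⟨q, inferInstance, hqpos, fun s hs => ?_⟩
  -- The exponential is unbounded on the negative axis; replacing `x` by `max x 0` makes it bounded
  -- without changing its integral against measures on `[0, ∞)`.
  let f : BoundedContinuousFunction ℝ ℝ :=
    BoundedContinuousFunction.ofNormedAddCommGroup (fun x : ℝ => Real.exp (-(s * max x 0)))
      (by fun_prop) 1 (fun x => exp_neg_mul_mem hs.le (le_max_right _ _))
  have hf : ∀ κ : Measure ℝ, (∀ᵐ x ∂κ, 0 ≤ x) → ∫ x, f x ∂κ = laplace κ s := by
    intro κ hκ
    refine integral_congr_ae (hκ.mono fun x hx => ?_)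
    simp only [f, BoundedContinuousFunction.coe_ofNormedAddCommGroup, max_eq_left hx]
  have h1 := hq f
  rw [hf _ hqpos] at h1
  refine tendsto_nhds_unique h1 (((hlim s hs).comp hg.tendsto_atTop).congr fun n => ?_)
  have := hf (μ (g n)) (hpos (g n))
  simp only [Function.comp]
  rw [← hlap _ s hs]
  exact this.symm

/-! ### Operations preserving Laplace transforms -/

lemma IsLaplaceTransform.mul {φ ψ : ℝ → ℝ} (hφ : IsLaplaceTransform φ)
    (hψ : IsLaplaceTransform ψ) : IsLaplaceTransform fun s => φ s * ψ s := by
  obtain ⟨μ, hμ, hμ0, hμl⟩ := hφ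
  obtain ⟨ν, hν, hν0, hνl⟩ := hψ
  have hadd : AEMeasurable (fun p : ℝ × ℝ => p.1 + p.2) (μ.prod ν) := by fun_prop
  refine ⟨(μ.prod ν).map fun p => p.1 + p.2, Measure.isProbabilityMeasure_map hadd, ?_, ?_⟩
  · rw [ae_map_iff hadd measurableSet_Ici]
    filter_upwards [Measure.quasiMeasurePreserving_fst.ae hμ0,
      Measure.quasiMeasurePreserving_snd.ae hν0] with p h1 h2 using add_nonneg h1 h2
  · intro s hs
    change _ = φ s * ψ s
    rw [laplace, integral_map hadd (by fun_prop), ← hμl s hs, ← hνl s hs, laplace, laplace,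
      ← integral_prod_mul]
    refine integral_congr_ae (Eventually.of_forall fun p => ?_)
    simp only
    rw [← Real.exp_add]
    congr 1; ring

lemma isLaplaceTransform_one : IsLaplaceTransform fun _ => 1 :=
  ⟨Measure.dirac 0, inferInstance, by simp [ae_dirac_eq], fun s _ => by simp [laplace]⟩

lemma IsLaplaceTransform.pow {φ : ℝ → ℝ} (hφ : IsLaplaceTransform φ) (n : ℕ) :
    IsLaplaceTransform fun s => φ s ^ n := by
  induction n with
  | zero => simpa using isLaplaceTransform_one
  | succ n ih => simpa only [pow_succ] using ih.mul hφ

/-- Mixtures of rescalings: with probability `w y` the variable is multiplied by `e^y`, and it is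
replaced by zero otherwise. -/
lemma IsLaplaceTransform.mixture {φ : ℝ → ℝ} (hφ : IsLaplaceTransform φ) (τ : Measure ℝ)
    [IsProbabilityMeasure τ] {w : ℝ → ℝ} (hw : Measurable w) (hw0 : ∀ y, 0 ≤ w y)
    (hw1 : ∀ y, w y ≤ 1) :
    IsLaplaceTransform fun s => 1 - ∫ y, w y * (1 - φ (s * Real.exp y)) ∂τ := by
  obtain ⟨μ, hμ, hμ0, hμl⟩ := hφ
  -- `α` carries the rescaled part and `β` the remaining mass, which is sent to `0`; together they
  -- have mass `1`.
  set α : Measure (ℝ × ℝ) := (τ.prod μ).withDensity fun p => ENNReal.ofReal (w p.1) with hα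
  set β : Measure ℝ := τ.withDensity fun y => ENNReal.ofReal (1 - w y) with hβ
  have hmul : Measurable fun p : ℝ × ℝ => Real.exp p.1 * p.2 := by fun_prop
  have hwi : Integrable w τ := Integrable.of_bound (by fun_prop) 1 (Eventually.of_forall fun y => by
    rw [Real.norm_of_nonneg (hw0 y)]; exact hw1 y)
  have hαu : α Set.univ = ∫⁻ y, ENNReal.ofReal (w y) ∂τ := by
    rw [hα, withDensity_apply _ MeasurableSet.univ, Measure.restrict_univ,
      lintegral_prod _ (by fun_prop)]
    simp
  have hβu : β Set.univ = ∫⁻ y, ENNReal.ofReal (1 - w y) ∂τ := by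
    rw [hβ, withDensity_apply _ MeasurableSet.univ, Measure.restrict_univ]
  have hsum : α Set.univ + β Set.univ = 1 := by
    rw [hαu, hβu, ← lintegral_add_left (by fun_prop)]
    simp_rw [← ENNReal.ofReal_add (hw0 _) (sub_nonneg.2 (hw1 _))]
    simp
  have hαfin : IsFiniteMeasure α := ⟨lt_of_le_of_lt (le_self_add.trans hsum.le) ENNReal.one_lt_top⟩
  have hβfin : IsFiniteMeasure β := ⟨lt_of_le_of_lt (le_add_self.trans hsum.le) ENNReal.one_lt_top⟩
  have hα0 : ∀ᵐ p ∂α, 0 ≤ p.2 :=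
    (withDensity_absolutelyContinuous _ _).ae_le (Measure.quasiMeasurePreserving_snd.ae hμ0)
  refine ⟨α.map (fun p => Real.exp p.1 * p.2) + β.map fun _ => 0, ⟨?_⟩, ?_, fun s hs => ?_⟩
  · rw [Measure.add_apply, Measure.map_apply hmul .univ, Measure.map_apply measurable_const .univ]
    simpa using hsum
  · rw [ae_add_measure_iff, ae_map_iff hmul.aemeasurable measurableSet_Ici,
      ae_map_iff measurable_const.aemeasurable measurableSet_Ici]
    exact ⟨hα0.mono fun p hp => mul_nonneg (Real.exp_pos _).le hp, by simp⟩
  · have hi1 : Integrable (fun x => Real.exp (-(s * x))) (α.map fun p => Real.exp p.1 * p.2) := by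
      refine integrable_exp_neg_mul ?_ hs.le
      rw [ae_map_iff hmul.aemeasurable measurableSet_Ici]
      exact hα0.mono fun p hp => mul_nonneg (Real.exp_pos _).le hp
    have hi2 : Integrable (fun x => Real.exp (-(s * x))) (β.map fun _ => 0) := by
      refine integrable_exp_neg_mul ?_ hs.le
      rw [ae_map_iff measurable_const.aemeasurable measurableSet_Ici]
      simp
    have hφm : Integrable (fun p : ℝ × ℝ => w p.1 * Real.exp (-(s * (Real.exp p.1 * p.2))))
        (τ.prod μ) := by
      refine Integrable.of_bound (by fun_prop) 1 ?_
      filter_upwards [Measure.quasiMeasurePreserving_snd.ae hμ0] with p hp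
      rw [norm_mul, Real.norm_of_nonneg (hw0 _)]
      exact mul_le_one₀ (hw1 _) (norm_nonneg _)
        (exp_neg_mul_mem hs.le (mul_nonneg (Real.exp_pos _).le hp))
    rw [laplace, integral_add_measure hi1 hi2, integral_map hmul.aemeasurable (by fun_prop),
      integral_map measurable_const.aemeasurable (by fun_prop)]
    have e1 : ∫ p, Real.exp (-(s * (Real.exp p.1 * p.2))) ∂α =
        ∫ y, w y * φ (s * Real.exp y) ∂τ := by
      rw [hα, integral_withDensity_eq_integral_toReal_smul (by fun_prop) (by simp)]
      simp only [ENNReal.toReal_ofReal (hw0 _), smul_eq_mul]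
      rw [integral_prod _ hφm]
      refine integral_congr_ae (Eventually.of_forall fun y => ?_)
      simp only
      rw [integral_const_mul, ← hμl _ (mul_pos hs (Real.exp_pos y)), laplace]
      simp only [mul_assoc]
    have e2 : ∫ _ : ℝ, Real.exp (-(s * 0)) ∂β = 1 - ∫ y, w y ∂τ := by
      rw [hβ, integral_withDensity_eq_integral_toReal_smul (by fun_prop) (by simp)]
      simp only [ENNReal.toReal_ofReal (sub_nonneg.2 (hw1 _)), smul_eq_mul, mul_zero, neg_zero,
        Real.exp_zero, mul_one]
      rw [integral_sub (integrable_const _) hwi]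
      simp
    have hi3 : Integrable (fun y => w y * φ (s * Real.exp y)) τ := by
      refine (hφm.integral_prod_left).congr (Eventually.of_forall fun y => ?_)
      simp only
      rw [integral_const_mul, ← hμl _ (mul_pos hs (Real.exp_pos y)), laplace]
      simp only [mul_assoc]
    rw [e1, e2]
    simp_rw [mul_sub, mul_one]
    rw [integral_sub hwi hi3]
    ring

/-- The Laplace transform with a given profile `h`, where `h (log s) = (1 - φ(s)) / s`. -/
noncomputable def ofProfile (h : ℝ → ℝ) (s : ℝ) : ℝ := 1 - s * h (Real.log s)

lemma mul_expQuot_log {s : ℝ} (hs : 0 < s) (u : ℝ) :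
    s * expQuot (Real.log s) u = 1 - Real.exp (-(s * u)) := by
  have := exp_mul_expQuot (Real.log s) u
  rwa [Real.exp_log hs] at this

/-- The target is `exp(-∫ e^(-y) (1 - φ(s e^y)) τ(dy))`, a compound Poisson transform whose
intensity `e^(-y) τ(dy)` may be infinite. It is the limit of `n`-th powers of mixtures with weights
`w n y`, since `n * w n y` is eventually `e^(-y)`. -/
lemma isLaplaceTransform_ofProfile_step {h : ℝ → ℝ} (hh : IsProfile h)
    (hl : IsLaplaceTransform (ofProfile h)) (τ : Measure ℝ) [IsProbabilityMeasure τ] :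
    IsLaplaceTransform (ofProfile (step τ h)) := by
  -- The cap at `1` makes the weights probabilities, and `n * w n y * e^y ≤ 1` keeps the means at
  -- most `1`, as the limit theorem requires.
  set w : ℕ → ℝ → ℝ := fun n y => min 1 (Real.exp (-y) / n) with hw
  have hw0 : ∀ n y, 0 ≤ w n y := fun n y => le_min zero_le_one (by positivity)
  have hw1 : ∀ n y, w n y ≤ 1 := fun n y => min_le_left _ _
  have hwm : ∀ n, Measurable (w n) := fun n => by fun_prop
  have hnw : ∀ (n : ℕ) y, n * w n y * Real.exp y ≤ 1 := by
    intro n y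
    have h1 : (n : ℝ) * w n y ≤ Real.exp (-y) := by
      rcases eq_or_ne (n : ℝ) 0 with hn | hn
      · rw [hn, zero_mul]; exact (Real.exp_pos _).le
      · refine (mul_le_mul_of_nonneg_left (min_le_right _ _) n.cast_nonneg).trans ?_
        rw [mul_div_cancel₀ _ hn]
    refine (mul_le_mul_of_nonneg_right h1 (Real.exp_pos y).le).trans ?_
    rw [← Real.exp_add]; simp
  set z : ℕ → ℝ → ℝ := fun n s => ∫ y, w n y * (1 - ofProfile h (s * Real.exp y)) ∂τ with hz
  have hpt : ∀ (n : ℕ) (s : ℝ), 0 < s → ∀ y, n * (w n y * (1 - ofProfile h (s * Real.exp y))) =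
      s * (n * w n y * Real.exp y * h (Real.log s + y)) := by
    intro n s hs y
    rw [ofProfile, Real.log_mul hs.ne' (Real.exp_pos y).ne', Real.log_exp]
    ring
  have hnz : ∀ (n : ℕ) (s : ℝ), 0 < s → n * z n s =
      s * ∫ y, n * w n y * Real.exp y * h (Real.log s + y) ∂τ := by
    intro n s hs
    simp only [hz]
    rw [← integral_const_mul, ← integral_const_mul]
    exact integral_congr_ae (Eventually.of_forall fun y => hpt n s hs y)
  have hhm := hh.anti.measurable
  have hbd : ∀ (n : ℕ) (s y : ℝ), ‖n * w n y * Real.exp y * h (Real.log s + y)‖ ≤ 1 := by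
    intro n s y
    have := hw0 n y
    rw [Real.norm_of_nonneg (mul_nonneg (by positivity) (hh.nonneg _))]
    exact mul_le_one₀ (hnw n y) (hh.nonneg _) (hh.le_one _)
  have hmeas : ∀ (n : ℕ) (s : ℝ),
      Measurable fun y => n * w n y * Real.exp y * h (Real.log s + y) := by
    intro n s
    have := hhm.comp (measurable_const_add (Real.log s))
    exact (((hwm n).const_mul _).mul Real.measurable_exp).mul this
  refine IsLaplaceTransform.of_tendsto (φ := fun n s => (1 - z n s) ^ n)
    (fun n => (hl.mixture τ (hwm n) (hw0 n) (hw1 n)).pow n) ?_ ?_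
  · intro n s hs
    obtain ⟨μ, hμ, hμ0, hμl⟩ := hl.mixture τ (hwm n) (hw0 n) (hw1 n)
    -- The mixture transform `1 - z n s` is non-negative, which is more than Bernoulli's inequality
    -- needs; that inequality then gives `1 - (1 - z n s)^n ≤ n * z n s ≤ s`.
    have hz1 : -2 ≤ -z n s := by
      have := laplace_nonneg μ s
      rw [hμl s hs] at this
      simp only [hz]
      linarith
    have hb := one_add_mul_le_pow hz1 n
    have hle : n * z n s ≤ s := by
      rw [hnz n s hs]
      refine mul_le_of_le_one_right hs.le ?_
      have := integral_mono (μ := τ) (Integrable.of_bound (hmeas n s).aestronglyMeasurable 1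
        (Eventually.of_forall fun y => hbd n s y)) (integrable_const 1)
        fun y => (le_abs_self _).trans (hbd n s y)
      simpa using this
    rw [← sub_eq_add_neg] at hb
    linarith
  · intro s hs
    have e : ofProfile (step τ h) s = Real.exp (-(s * ∫ y, h (Real.log s + y) ∂τ)) := by
      rw [ofProfile, step, mul_expQuot_log hs]; ring
    rw [e]
    simp_rw [sub_eq_add_neg]
    refine Real.tendsto_one_add_pow_exp_of_tendsto (g := fun n => -z n s) ?_
    simp_rw [mul_neg, hnz _ s hs]
    refine (Tendsto.const_mul s ?_).neg
    refine tendsto_integral_of_dominated_convergence (fun _ => 1)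
      (fun n => (hmeas n s).aestronglyMeasurable) (integrable_const _)
      (fun n => Eventually.of_forall fun y => hbd n s y) (Eventually.of_forall fun y => ?_)
    refine tendsto_const_nhds.congr' ?_
    obtain ⟨N, hN⟩ := exists_nat_ge (Real.exp (-y))
    filter_upwards [eventually_ge_atTop N] with n hn
    have hn' : Real.exp (-y) ≤ n := hN.trans (by exact_mod_cast hn)
    have hn0 : (0 : ℝ) < n := (Real.exp_pos _).trans_le hn'
    simp only [hw]
    rw [min_eq_right ((div_le_one hn0).2 hn'), mul_div_cancel₀ _ hn0.ne', ← Real.exp_add]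
    simp

lemma isLaplaceTransform_ofProfile_iter (τ : Measure ℝ) [IsProbabilityMeasure τ] (n : ℕ) :
    IsLaplaceTransform (ofProfile (iter τ n)) := by
  induction n with
  | zero =>
    refine ⟨Measure.dirac 1, inferInstance, by simp [ae_dirac_eq], fun s hs => ?_⟩
    rw [ofProfile, iter_zero, mul_expQuot_log hs]
    simp [laplace]
  | succ n ih =>
    rw [iter_succ]
    exact isLaplaceTransform_ofProfile_step (isProfile_iter τ n) ih τ

lemma isLaplaceTransform_ofProfile_limitProfile (τ : Measure ℝ) [IsProbabilityMeasure τ] :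
    IsLaplaceTransform (ofProfile (limitProfile τ)) := by
  refine IsLaplaceTransform.of_tendsto (isLaplaceTransform_ofProfile_iter τ) (fun n s hs => ?_)
    fun s hs => ?_
  · rw [ofProfile, sub_sub_cancel]
    exact mul_le_of_le_one_right hs.le ((isProfile_iter τ n).le_one _)
  · exact tendsto_const_nhds.sub ((tendsto_iter τ _).const_mul s)

/-! ### The fixed-point equation for the Laplace transform -/

/-- The negative of the derivative of the Laplace transform. -/
noncomputable def laplaceMean (μ : Measure ℝ) (s : ℝ) : ℝ := ∫ x, x * Real.exp (-(s * x)) ∂μ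

lemma measurable_laplace (μ : Measure ℝ) [SFinite μ] : Measurable (laplace μ) :=
  (StronglyMeasurable.integral_prod_right (f := fun s x => Real.exp (-(s * x)))
    (Measurable.stronglyMeasurable (by fun_prop))).measurable

lemma measurable_laplaceMean (μ : Measure ℝ) [SFinite μ] : Measurable (laplaceMean μ) :=
  (StronglyMeasurable.integral_prod_right (f := fun s x => x * Real.exp (-(s * x)))
    (Measurable.stronglyMeasurable (by fun_prop))).measurable

section transform

variable {μ : Measure ℝ}

lemma integrable_mul_exp (hμ : ∀ᵐ x ∂μ, 0 ≤ x) (hi : Integrable (fun x => x) μ) {s : ℝ}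
    (hs : 0 ≤ s) : Integrable (fun x => x * Real.exp (-(s * x))) μ := by
  refine hi.mono' (by fun_prop) (hμ.mono fun x hx => ?_)
  rw [norm_mul, Real.norm_of_nonneg hx]
  exact mul_le_of_le_one_right hx (exp_neg_mul_mem hs hx)

lemma laplaceMean_nonneg (hμ : ∀ᵐ x ∂μ, 0 ≤ x) (s : ℝ) : 0 ≤ laplaceMean μ s :=
  integral_nonneg_of_ae (hμ.mono fun _ hx => mul_nonneg hx (Real.exp_pos _).le)

lemma laplaceMean_le (hμ : ∀ᵐ x ∂μ, 0 ≤ x) (hi : Integrable (fun x => x) μ) {s : ℝ}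
    (hs : 0 ≤ s) : laplaceMean μ s ≤ ∫ x, x ∂μ :=
  integral_mono_ae (integrable_mul_exp hμ hi hs) hi (hμ.mono fun _ hx =>
    mul_le_of_le_one_right hx ((le_abs_self _).trans (exp_neg_mul_mem hs hx)))

lemma hasDerivAt_laplace [IsProbabilityMeasure μ] (hμ : ∀ᵐ x ∂μ, 0 ≤ x) (hi : Integrable (fun x => x) μ) {s : ℝ}
    (hs : 0 < s) : HasDerivAt (laplace μ) (-laplaceMean μ s) s := by
  have h := hasDerivAt_integral_of_dominated_loc_of_deriv_le (μ := μ) (s := Set.Ioi 0)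
    (F := fun s x => Real.exp (-(s * x))) (F' := fun s x => -(x * Real.exp (-(s * x))))
    (x₀ := s) (bound := fun x => x) (Ioi_mem_nhds hs) (Eventually.of_forall fun _ => by fun_prop)
    (integrable_exp_neg_mul hμ hs.le) (by fun_prop)
    (hμ.mono fun x hx t ht => by
      rw [norm_neg, norm_mul, Real.norm_of_nonneg hx]
      exact mul_le_of_le_one_right hx (exp_neg_mul_mem (le_of_lt ht) hx)) hi
    (Eventually.of_forall fun x t _ => by
      refine HasDerivAt.congr_deriv ((hasDerivAt_id t).mul_const x).neg.exp ?_
      simp only [Pi.neg_apply, id]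
      ring)
  rw [laplaceMean, ← integral_neg]
  exact h.2

lemma one_sub_laplace_le [IsProbabilityMeasure μ] (hμ : ∀ᵐ x ∂μ, 0 ≤ x) (hi : Integrable (fun x => x) μ) {s : ℝ}
    (hs : 0 ≤ s) : 1 - laplace μ s ≤ s * ∫ x, x ∂μ := by
  have e : 1 - laplace μ s = ∫ x, (1 - Real.exp (-(s * x))) ∂μ := by
    rw [integral_sub (integrable_const _) (integrable_exp_neg_mul hμ hs)]
    simp [laplace]
  rw [e, ← integral_const_mul]
  refine integral_mono ((integrable_const _).sub (integrable_exp_neg_mul hμ hs))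
    (hi.const_mul s) fun x => ?_
  have := Real.add_one_le_exp (-(s * x))
  simp only
  linarith

/-- The exponent `E[(1 - φ(s A)) / A]`, where `A = e^y` and `y` has law `τ`. -/
noncomputable def exponent (τ μ : Measure ℝ) (s : ℝ) : ℝ :=
  ∫ y, Real.exp (-y) * (1 - laplace μ (s * Real.exp y)) ∂τ

/-- The bound `1 - φ(t) ≤ t m` at `t = s e^y` cancels the factor `e^(-y)`, so the exponent is finite
without any moment condition on `A` or `1/A`. -/
lemma exponent_integrand_mem [IsProbabilityMeasure μ] (hμ : ∀ᵐ x ∂μ, 0 ≤ x) (hi : Integrable (fun x => x) μ) {s : ℝ}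
    (hs : 0 ≤ s) (y : ℝ) : 0 ≤ Real.exp (-y) * (1 - laplace μ (s * Real.exp y)) ∧
      Real.exp (-y) * (1 - laplace μ (s * Real.exp y)) ≤ s * ∫ x, x ∂μ := by
  have hsy : 0 ≤ s * Real.exp y := by positivity
  refine ⟨mul_nonneg (Real.exp_pos _).le (sub_nonneg.2 (laplace_le_one hμ hsy)), ?_⟩
  refine (mul_le_mul_of_nonneg_left (one_sub_laplace_le hμ hi hsy) (Real.exp_pos _).le).trans ?_
  have : Real.exp (-y) * Real.exp y = 1 := by rw [← Real.exp_add]; simp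
  refine le_of_eq ?_
  linear_combination (s * ∫ x, x ∂μ) * this

variable (τ : Measure ℝ) [IsProbabilityMeasure τ]

lemma integrable_exponent [IsProbabilityMeasure μ] (hμ : ∀ᵐ x ∂μ, 0 ≤ x) (hi : Integrable (fun x => x) μ) {s : ℝ}
    (hs : 0 ≤ s) :
    Integrable (fun y => Real.exp (-y) * (1 - laplace μ (s * Real.exp y))) τ := by
  have := measurable_laplace μ
  refine Integrable.of_bound (by fun_prop) (s * ∫ x, x ∂μ) (Eventually.of_forall fun y => ?_)
  have h := exponent_integrand_mem hμ hi hs y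
  rw [Real.norm_of_nonneg h.1]
  exact h.2

lemma exponent_mem [IsProbabilityMeasure μ] (hμ : ∀ᵐ x ∂μ, 0 ≤ x) (hi : Integrable (fun x => x) μ) {s : ℝ}
    (hs : 0 ≤ s) : 0 ≤ exponent τ μ s ∧ exponent τ μ s ≤ s * ∫ x, x ∂μ := by
  refine ⟨integral_nonneg fun y => (exponent_integrand_mem hμ hi hs y).1, ?_⟩
  have := integral_mono (integrable_exponent τ hμ hi hs) (integrable_const (s * ∫ x, x ∂μ))
    fun y => (exponent_integrand_mem hμ hi hs y).2
  simpa [exponent] using this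

lemma hasDerivAt_exponent [IsProbabilityMeasure μ] (hμ : ∀ᵐ x ∂μ, 0 ≤ x) (hi : Integrable (fun x => x) μ) {s : ℝ}
    (hs : 0 < s) :
    HasDerivAt (exponent τ μ) (∫ y, laplaceMean μ (s * Real.exp y) ∂τ) s := by
  have hm := measurable_laplace μ
  have hm' := measurable_laplaceMean μ
  refine (hasDerivAt_integral_of_dominated_loc_of_deriv_le (μ := τ) (s := Set.Ioi 0)
    (F := fun s y => Real.exp (-y) * (1 - laplace μ (s * Real.exp y)))
    (F' := fun s y => laplaceMean μ (s * Real.exp y))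
    (bound := fun _ => ∫ x, x ∂μ) (Ioi_mem_nhds hs)
    (Eventually.of_forall fun _ => by fun_prop) (integrable_exponent τ hμ hi hs.le)
    (Measurable.aestronglyMeasurable (by fun_prop))
    (Eventually.of_forall fun y t ht => ?_) (integrable_const _)
    (Eventually.of_forall fun y t ht => ?_)).2
  · rw [Real.norm_of_nonneg (laplaceMean_nonneg hμ _)]
    exact laplaceMean_le hμ hi (mul_pos ht (Real.exp_pos y)).le
  · have h1 := (hasDerivAt_laplace hμ hi (mul_pos ht (Real.exp_pos y))).comp t
      ((hasDerivAt_id t).mul_const (Real.exp y))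
    have h2 := (h1.const_sub 1).const_mul (Real.exp (-y))
    refine h2.congr_deriv ?_
    have : Real.exp (-y) * Real.exp y = 1 := by rw [← Real.exp_add]; simp
    linear_combination laplaceMean μ (t * Real.exp y) * this

/-- The differential form and the integrated form of the equation are equivalent. -/
lemma laplace_eq_exp_neg_exponent_iff [IsProbabilityMeasure μ] (hμ : ∀ᵐ x ∂μ, 0 ≤ x) (hi : Integrable (fun x => x) μ) :
    (∀ s, 0 < s → laplace μ s = Real.exp (-exponent τ μ s)) ↔
      ∀ s, 0 < s → laplaceMean μ s = laplace μ s * ∫ y, laplaceMean μ (s * Real.exp y) ∂τ := by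
  -- Integrating factor: `F = 1` is the integrated equation, `F' = 0` the differential one.
  set F : ℝ → ℝ := fun s => laplace μ s * Real.exp (exponent τ μ s) with hF
  have hderiv : ∀ s, 0 < s → HasDerivAt F (Real.exp (exponent τ μ s) *
      (laplace μ s * (∫ y, laplaceMean μ (s * Real.exp y) ∂τ) - laplaceMean μ s)) s := by
    intro s hs
    refine ((hasDerivAt_laplace hμ hi hs).mul (hasDerivAt_exponent τ hμ hi hs).exp).congr_deriv ?_
    ring
  have hiff : ∀ s, laplace μ s = Real.exp (-exponent τ μ s) ↔ F s = 1 := by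
    intro s
    rw [hF, Real.exp_neg, mul_eq_one_iff_eq_inv₀ (Real.exp_pos _).ne']
  constructor
  · intro h s hs
    have h1 : HasDerivAt F 0 s := by
      refine (hasDerivAt_const s (1 : ℝ)).congr_of_eventuallyEq ?_
      filter_upwards [Ioi_mem_nhds hs] with t ht
      exact (hiff t).1 (h t ht)
    have h2 := (hderiv s hs).unique h1
    have h3 := (mul_eq_zero.1 h2).resolve_left (Real.exp_pos _).ne'
    linarith
  · intro h s hs
    rw [hiff]
    have h0 : ∀ t, 0 < t → HasDerivAt F 0 t := by
      intro t ht
      have := hderiv t ht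
      rwa [← h t ht, sub_self, mul_zero] at this
    have hconst : ∀ t, 0 < t → F t = F s := by
      intro t ht
      refine isOpen_Ioi.is_const_of_deriv_eq_zero isPreconnected_Ioi
        (fun u hu => (h0 u hu).differentiableAt.differentiableWithinAt)
        (fun u hu => (h0 u hu).deriv) ht hs
    have hm : Tendsto (fun t : ℝ => t * ∫ x, x ∂μ) (𝓝[>] 0) (𝓝 0) := by
      have : Tendsto (fun t : ℝ => t * ∫ x, x ∂μ) (𝓝 0) (𝓝 (0 * ∫ x, x ∂μ)) :=
        (continuous_id.mul continuous_const).tendsto 0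
      rw [zero_mul] at this
      exact this.mono_left nhdsWithin_le_nhds
    have hl : Tendsto (laplace μ) (𝓝[>] 0) (𝓝 1) := by
      have h1 : Tendsto (fun t : ℝ => 1 - t * ∫ x, x ∂μ) (𝓝[>] 0) (𝓝 1) := by
        simpa using hm.const_sub 1
      refine tendsto_of_tendsto_of_tendsto_of_le_of_le' h1 tendsto_const_nhds ?_ ?_
      · filter_upwards [self_mem_nhdsWithin] with t ht
        linarith [one_sub_laplace_le hμ hi (le_of_lt ht)]
      · filter_upwards [self_mem_nhdsWithin] with t ht
        exact laplace_le_one hμ (le_of_lt ht)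
    have he : Tendsto (exponent τ μ) (𝓝[>] 0) (𝓝 0) := by
      refine tendsto_of_tendsto_of_tendsto_of_le_of_le' tendsto_const_nhds hm ?_ ?_
      · filter_upwards [self_mem_nhdsWithin] with t ht
        exact (exponent_mem τ hμ hi (le_of_lt ht)).1
      · filter_upwards [self_mem_nhdsWithin] with t ht
        exact (exponent_mem τ hμ hi (le_of_lt ht)).2
    -- The limit at `0` identifies the constant value of `F`.
    have hlim : Tendsto F (𝓝[>] 0) (𝓝 1) := by
      have := hl.mul he.rexp
      simpa using this
    refine tendsto_nhds_unique (tendsto_const_nhds.congr' ?_) hlim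
    filter_upwards [self_mem_nhdsWithin] with t ht
    exact (hconst t ht).symm

/-! ### The size-biased equation -/

lemma mean_eq_ofReal_integral (hμ : ∀ᵐ x ∂μ, 0 ≤ x) (hi : Integrable (fun x => x) μ) :
    mean μ = ENNReal.ofReal (∫ x, x ∂μ) :=
  (ofReal_integral_eq_lintegral_ofReal hi hμ).symm

lemma integrable_of_mean_ne_top (hμ : ∀ᵐ x ∂μ, 0 ≤ x) (h : mean μ ≠ ∞) :
    Integrable (fun x => x) μ :=
  (lintegral_ofReal_ne_top_iff_integrable (by fun_prop) hμ).1 h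

lemma eq_dirac_zero_of_integral_eq_zero [IsProbabilityMeasure μ] (hμ : ∀ᵐ x ∂μ, 0 ≤ x) (hi : Integrable (fun x => x) μ)
    (h : ∫ x, x ∂μ = 0) : μ = Measure.dirac 0 := by
  have h0 : (fun x => x) =ᵐ[μ] fun _ => (0 : ℝ) := (integral_eq_zero_iff_of_nonneg_ae hμ hi).1 h
  have := Measure.map_congr (mβ := Real.measurableSpace) h0
  rw [Measure.map_id', Measure.map_const] at this
  simpa using this

lemma integral_sizeBiased (hμ : ∀ᵐ x ∂μ, 0 ≤ x) (hi : Integrable (fun x => x) μ) (f : ℝ → ℝ) :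
    ∫ x, f x ∂(sizeBiased μ) = (∫ x, x ∂μ)⁻¹ * ∫ x, x * f x ∂μ := by
  rw [sizeBiased, integral_smul_measure,
    integral_withDensity_eq_integral_toReal_smul (by fun_prop) (by simp),
    mean_eq_ofReal_integral hμ hi, ENNReal.toReal_inv,
    ENNReal.toReal_ofReal (integral_nonneg_of_ae hμ), smul_eq_mul]
  congr 1
  refine integral_congr_ae (hμ.mono fun x hx => ?_)
  simp only [ENNReal.toReal_ofReal hx, smul_eq_mul]

lemma laplace_sizeBiased (hμ : ∀ᵐ x ∂μ, 0 ≤ x) (hi : Integrable (fun x => x) μ) (s : ℝ) :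
    laplace (sizeBiased μ) s = (∫ x, x ∂μ)⁻¹ * laplaceMean μ s :=
  integral_sizeBiased hμ hi _

lemma ae_nonneg_sizeBiased (hμ : ∀ᵐ x ∂μ, 0 ≤ x) : ∀ᵐ x ∂(sizeBiased μ), 0 ≤ x :=
  Measure.ae_smul_measure ((withDensity_absolutelyContinuous _ _).ae_le hμ) _

lemma isProbabilityMeasure_sizeBiased (h0 : mean μ ≠ 0) (h1 : mean μ ≠ ∞) :
    IsProbabilityMeasure (sizeBiased μ) := by
  constructor
  rw [sizeBiased, Measure.smul_apply, withDensity_apply _ .univ, Measure.restrict_univ]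
  exact ENNReal.inv_mul_cancel h0 h1

lemma laplace_affine {ν : Measure ℝ} [IsProbabilityMeasure μ] [IsProbabilityMeasure ν]
    (hμ : ∀ᵐ x ∂μ, 0 ≤ x)
    (hν : ∀ᵐ x ∂ν, 0 ≤ x) {s : ℝ} (hs : 0 ≤ s) :
    (∀ᵐ x ∂((τ.map Real.exp).prod (ν.prod μ)).map fun p : ℝ × ℝ × ℝ => p.1 * p.2.1 + p.2.2,
      0 ≤ x) ∧
    laplace (((τ.map Real.exp).prod (ν.prod μ)).map
      fun p : ℝ × ℝ × ℝ => p.1 * p.2.1 + p.2.2) s =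
        (∫ y, laplace ν (s * Real.exp y) ∂τ) * laplace μ s := by
  have hexp : AEMeasurable Real.exp τ := by fun_prop
  have : IsProbabilityMeasure (τ.map Real.exp) := Measure.isProbabilityMeasure_map hexp
  have hm : AEMeasurable (fun p : ℝ × ℝ × ℝ => p.1 * p.2.1 + p.2.2)
      ((τ.map Real.exp).prod (ν.prod μ)) := by fun_prop
  have hρ : ∀ᵐ a ∂(τ.map Real.exp), 0 ≤ a := by
    rw [ae_map_iff hexp measurableSet_Ici]
    exact Eventually.of_forall fun y => (Real.exp_pos y).le
  have hnn : ∀ᵐ p ∂((τ.map Real.exp).prod (ν.prod μ)), 0 ≤ p.1 * p.2.1 + p.2.2 := by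
    filter_upwards [Measure.quasiMeasurePreserving_fst.ae hρ,
      Measure.quasiMeasurePreserving_snd.ae (Measure.quasiMeasurePreserving_fst.ae hν),
      Measure.quasiMeasurePreserving_snd.ae (Measure.quasiMeasurePreserving_snd.ae hμ)]
      with p h1 h2 h3
    exact add_nonneg (mul_nonneg h1 h2) h3
  refine ⟨(ae_map_iff hm measurableSet_Ici).2 hnn, ?_⟩
  have hlm := measurable_laplace ν
  rw [laplace, integral_map hm (by fun_prop), integral_prod _ (Integrable.of_bound (by fun_prop) 1
    (hnn.mono fun p hp => exp_neg_mul_mem hs hp)), ← integral_mul_const,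
    integral_map hexp
      (Measurable.aestronglyMeasurable (StronglyMeasurable.integral_prod_right
        (f := fun (a : ℝ) (q : ℝ × ℝ) => Real.exp (-(s * (a * q.1 + q.2))))
        (Measurable.stronglyMeasurable (by fun_prop))).measurable)]
  refine integral_congr_ae (Eventually.of_forall fun y => ?_)
  simp only
  rw [laplace, laplace, ← integral_prod_mul]
  refine integral_congr_ae (Eventually.of_forall fun q => ?_)
  simp only
  rw [← Real.exp_add]
  congr 1; ring

/-- By independence the transform of the right-hand side factorises; the normalising factor `m⁻¹`
cancels, leaving the differential equation. Laplace uniqueness turns equality of transforms back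
into equality of laws. -/
lemma sizeBiased_equation_iff [IsProbabilityMeasure μ] (hμ : ∀ᵐ x ∂μ, 0 ≤ x) (hi : Integrable (fun x => x) μ)
    (hpos : 0 < ∫ x, x ∂μ) :
    sizeBiased μ = ((τ.map Real.exp).prod ((sizeBiased μ).prod μ)).map
      (fun p : ℝ × ℝ × ℝ => p.1 * p.2.1 + p.2.2) ↔
    ∀ s, 0 < s → laplace μ s = Real.exp (-exponent τ μ s) := by
  have hmean := mean_eq_ofReal_integral hμ hi
  have : IsProbabilityMeasure (sizeBiased μ) := isProbabilityMeasure_sizeBiased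
    (by rw [hmean]; simpa using hpos) (by rw [hmean]; simp)
  have : IsProbabilityMeasure (τ.map Real.exp) :=
    Measure.isProbabilityMeasure_map (by fun_prop)
  have hsb := ae_nonneg_sizeBiased hμ
  have hlap : ∀ s, 0 < s → (laplace (sizeBiased μ) s =
      laplace (((τ.map Real.exp).prod ((sizeBiased μ).prod μ)).map
        (fun p : ℝ × ℝ × ℝ => p.1 * p.2.1 + p.2.2)) s ↔
      laplaceMean μ s = laplace μ s * ∫ y, laplaceMean μ (s * Real.exp y) ∂τ) := by
    intro s hs
    rw [(laplace_affine τ hμ hsb hs.le).2]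
    simp_rw [laplace_sizeBiased hμ hi]
    rw [integral_const_mul, mul_assoc, mul_right_inj' (inv_pos.2 hpos).ne', mul_comm (laplace μ s)]
  rw [laplace_eq_exp_neg_exponent_iff τ hμ hi]
  constructor
  · intro h s hs
    exact (hlap s hs).1 (congrArg (fun κ => laplace κ s) h)
  · intro h
    refine ext_of_laplace hsb (laplace_affine τ hμ hsb zero_le_one).1 fun s hs => ?_
    exact (hlap s hs).2 (h s hs)

end transform

/-- Non-zero solutions in terms of Laplace transforms. -/
lemma isNonzeroSolution_iff (τ μ : Measure ℝ) [IsProbabilityMeasure τ] :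
    IsNonzeroSolution (τ.map Real.exp) μ ↔ IsProbabilityMeasure μ ∧ (∀ᵐ x ∂μ, 0 ≤ x) ∧
      Integrable (fun x => x) μ ∧ 0 < ∫ x, x ∂μ ∧
      ∀ s, 0 < s → laplace μ s = Real.exp (-exponent τ μ s) := by
  constructor
  · rintro ⟨h1, h2, h3, h4, h5⟩
    have hμ := ae_nonneg_of_measure_Iio h2
    have hi := integrable_of_mean_ne_top hμ h3
    have hpos : 0 < ∫ x, x ∂μ := (integral_nonneg_of_ae hμ).lt_of_ne' fun h =>
      h4 (eq_dirac_zero_of_integral_eq_zero hμ hi h)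
    exact ⟨h1, hμ, hi, hpos, (sizeBiased_equation_iff τ hμ hi hpos).1 h5⟩
  · rintro ⟨h1, hμ, hi, hpos, h5⟩
    refine ⟨h1, measure_Iio_of_ae_nonneg hμ, ?_, ?_, (sizeBiased_equation_iff τ hμ hi hpos).2 h5⟩
    · rw [mean_eq_ofReal_integral hμ hi]; simp
    · rintro rfl
      simp at hpos

/-! ### The profile of a measure -/

/-- The function `(1 - φ(s)) / s` at `s = e^x`, for the Laplace transform `φ` of `μ`. -/
noncomputable def profile (μ : Measure ℝ) (x : ℝ) : ℝ := ∫ t, expQuot x t ∂μ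

section profile

variable {μ : Measure ℝ}

lemma profile_eq [IsProbabilityMeasure μ] (hμ : ∀ᵐ x ∂μ, 0 ≤ x) (x : ℝ) :
    profile μ x = Real.exp (-x) * (1 - laplace μ (Real.exp x)) := by
  simp only [profile, expQuot]
  rw [integral_const_mul, integral_sub (integrable_const _)
    (integrable_exp_neg_mul hμ (Real.exp_pos x).le)]
  simp [laplace]

lemma norm_expQuot_le (x : ℝ) {t : ℝ} (ht : 0 ≤ t) : ‖expQuot x t‖ ≤ Real.exp (-x) := by
  rw [Real.norm_of_nonneg (expQuot_nonneg x ht)]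
  exact expQuot_le_exp_neg x t

lemma integrable_expQuot [IsProbabilityMeasure μ] (hμ : ∀ᵐ x ∂μ, 0 ≤ x) (x : ℝ) : Integrable (expQuot x) μ :=
  Integrable.of_bound (expQuot_continuous x).aestronglyMeasurable (Real.exp (-x))
    (hμ.mono fun _ ht => norm_expQuot_le x ht)

lemma profile_anti [IsProbabilityMeasure μ] (hμ : ∀ᵐ x ∂μ, 0 ≤ x) : Antitone (profile μ) := fun x y hxy =>
  integral_mono (integrable_expQuot hμ y) (integrable_expQuot hμ x)
    fun t => expQuot_anti_left t hxy

lemma profile_nonneg (hμ : ∀ᵐ x ∂μ, 0 ≤ x) (x : ℝ) : 0 ≤ profile μ x :=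
  integral_nonneg_of_ae (hμ.mono fun _ ht => expQuot_nonneg x ht)

lemma profile_le [IsProbabilityMeasure μ] (hμ : ∀ᵐ x ∂μ, 0 ≤ x) (hi : Integrable (fun x => x) μ) (x : ℝ) :
    profile μ x ≤ ∫ t, t ∂μ :=
  integral_mono (integrable_expQuot hμ x) hi fun t => expQuot_le x t

lemma profile_le_exp_neg [IsProbabilityMeasure μ] (hμ : ∀ᵐ x ∂μ, 0 ≤ x) (x : ℝ) : profile μ x ≤ Real.exp (-x) := by
  have := integral_mono (integrable_expQuot hμ x) (integrable_const (Real.exp (-x)))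
    fun t => expQuot_le_exp_neg x t
  simpa [profile] using this

lemma abs_profile_le [IsProbabilityMeasure μ] (hμ : ∀ᵐ x ∂μ, 0 ≤ x) (hi : Integrable (fun x => x) μ) (x : ℝ) :
    |profile μ x| ≤ ∫ t, t ∂μ := by
  rw [abs_of_nonneg (profile_nonneg hμ x)]
  exact profile_le hμ hi x

lemma tendsto_expQuot_left {t : ℝ} (ht : 0 ≤ t) :
    Tendsto (fun x => expQuot x t) atBot (𝓝 t) := by
  refine tendsto_of_tendsto_of_tendsto_of_le_of_le (g := fun x => t - Real.exp x * t ^ 2) ?_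
    tendsto_const_nhds (fun x => sub_le_expQuot x ht) fun x => expQuot_le x t
  simpa using (Real.tendsto_exp_atBot.mul_const (t ^ 2)).const_sub t

lemma tendsto_profile_atBot (hμ : ∀ᵐ x ∂μ, 0 ≤ x) (hi : Integrable (fun x => x) μ) :
    Tendsto (profile μ) atBot (𝓝 (∫ t, t ∂μ)) := by
  refine tendsto_integral_filter_of_dominated_convergence (fun t => t)
    (Eventually.of_forall fun x => (expQuot_continuous x).aestronglyMeasurable)
    (Eventually.of_forall fun x => hμ.mono fun t ht => ?_) hi
    (hμ.mono fun t ht => tendsto_expQuot_left ht)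
  rw [Real.norm_of_nonneg (expQuot_nonneg x ht)]
  exact expQuot_le x t

lemma tendsto_profile_atTop [IsProbabilityMeasure μ] (hμ : ∀ᵐ x ∂μ, 0 ≤ x) : Tendsto (profile μ) atTop (𝓝 0) :=
  squeeze_zero (profile_nonneg hμ) (profile_le_exp_neg hμ) Real.tendsto_exp_neg_atTop_nhds_zero

lemma profile_pos [IsProbabilityMeasure μ] (hμ : ∀ᵐ x ∂μ, 0 ≤ x) (hpos : 0 < ∫ t, t ∂μ) (x : ℝ) : 0 < profile μ x := by
  refine (profile_nonneg hμ x).lt_of_ne' fun h => hpos.ne' ?_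
  have h0 := (integral_eq_zero_iff_of_nonneg_ae (hμ.mono fun _ ht => expQuot_nonneg x ht)
    (integrable_expQuot hμ x)).1 h
  refine integral_eq_zero_of_ae ?_
  filter_upwards [h0, hμ] with t h1 h2
  simp only [Pi.zero_apply] at h1 ⊢
  by_contra hne
  have h3 := exp_mul_expQuot x t
  rw [h1, mul_zero] at h3
  have h4 : Real.exp (-(Real.exp x * t)) < 1 :=
    Real.exp_lt_one_iff.2 (neg_neg_of_pos (mul_pos (Real.exp_pos x) (h2.lt_of_ne' hne)))
  linarith

lemma integrable_profile_translate [IsProbabilityMeasure μ] (hμ : ∀ᵐ x ∂μ, 0 ≤ x) (hi : Integrable (fun x => x) μ)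
    (τ : Measure ℝ) [IsProbabilityMeasure τ] (x : ℝ) :
    Integrable (fun y => profile μ (x + y)) τ :=
  integrable_translate (profile_anti hμ).measurable (abs_profile_le hμ hi) τ x

lemma exponent_exp [IsProbabilityMeasure μ] (hμ : ∀ᵐ x ∂μ, 0 ≤ x) (τ : Measure ℝ) (x : ℝ) :
    exponent τ μ (Real.exp x) = Real.exp x * ∫ y, profile μ (x + y) ∂τ := by
  rw [exponent, ← integral_const_mul]
  refine integral_congr_ae (Eventually.of_forall fun y => ?_)
  simp only
  have : Real.exp (-y) = Real.exp x * Real.exp (-(x + y)) := by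
    rw [← Real.exp_add]; congr 1; ring
  rw [profile_eq hμ, this, Real.exp_add x y, mul_assoc]

lemma profile_eq_expQuot {τ : Measure ℝ} [IsProbabilityMeasure μ] (hμ : ∀ᵐ x ∂μ, 0 ≤ x)
    (h : ∀ s, 0 < s → laplace μ s = Real.exp (-exponent τ μ s)) (x : ℝ) :
    profile μ x = expQuot x (∫ y, profile μ (x + y) ∂τ) := by
  rw [profile_eq hμ, h _ (Real.exp_pos x), exponent_exp hμ, expQuot]

end profile

/-! ### Necessity of the negative drift -/

/-- A solution's profile is positive everywhere, hence so is its average, and `expQuot_lt` is strict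
there. Thus `-profile μ` is strictly superharmonic and increases from `-m` to `0`. -/
lemma drift_neg_of_isNonzeroSolution {τ μ : Measure ℝ} [IsProbabilityMeasure τ]
    (hτ : ∫⁻ y, ENNReal.ofReal y ∂τ ≠ ∞ ∨ ∫⁻ y, ENNReal.ofReal (-y) ∂τ ≠ ∞)
    (h : IsNonzeroSolution (τ.map Real.exp) μ) :
    ∫⁻ y, ENNReal.ofReal y ∂τ < ∫⁻ y, ENNReal.ofReal (-y) ∂τ := by
  obtain ⟨_, hμ, hi, hpos, heq⟩ := (isNonzeroSolution_iff τ μ).1 h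
  refine drift_lt_of_superharmonic (f := fun x => -profile μ x) (profile_anti hμ).neg
    (neg_lt_neg hpos) (tendsto_profile_atBot hμ hi).neg (tendsto_profile_atTop hμ).neg τ hτ
    fun x => ?_
  rw [integral_neg, neg_lt_neg_iff]
  have hx := profile_eq_expQuot hμ heq x
  have h0 : 0 < ∫ y, profile μ (x + y) ∂τ := by
    by_contra! hle
    have := (expQuot_le x (∫ y, profile μ (x + y) ∂τ)).trans hle
    linarith [profile_pos hμ hpos x]
  conv_lhs => rw [hx]
  exact expQuot_lt x h0

/-! ### Uniqueness -/

/-- The derivative in `u` is `e^(-e^x u)`, at most `1` for `u ≥ 0`. This non-expansiveness makes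
distances between fixed points subharmonic. -/
lemma expQuot_sub_le (x : ℝ) {u v : ℝ} (hu : 0 ≤ u) (huv : u ≤ v) :
    expQuot x v - expQuot x u ≤ v - u := by
  have h1 := exp_mul_expQuot x u
  have h2 := exp_mul_expQuot x v
  have hx := Real.exp_pos x
  have h3 := Real.add_one_le_exp (-(Real.exp x * (v - u)))
  have h4 : Real.exp (-(Real.exp x * v)) =
      Real.exp (-(Real.exp x * u)) * Real.exp (-(Real.exp x * (v - u))) := by
    rw [← Real.exp_add]; congr 1; ring
  have h5 : Real.exp (-(Real.exp x * u)) ≤ 1 := Real.exp_le_one_iff.2 (by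
    rw [neg_nonpos]; positivity)
  have h6 : 0 ≤ Real.exp x * (v - u) := mul_nonneg hx.le (sub_nonneg.2 huv)
  refine le_of_mul_le_mul_left ?_ hx
  have h7 := Real.exp_pos (-(Real.exp x * u))
  rw [mul_sub, h1, h2, h4]
  nlinarith

lemma abs_expQuot_sub_le (x : ℝ) {u v : ℝ} (hu : 0 ≤ u) (hv : 0 ≤ v) :
    |expQuot x u - expQuot x v| ≤ |u - v| := by
  rcases le_total u v with h | h
  · rw [abs_sub_comm, abs_of_nonneg (sub_nonneg.2 (expQuot_mono x h)), abs_sub_comm,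
      abs_of_nonneg (sub_nonneg.2 h)]
    exact expQuot_sub_le x hu h
  · rw [abs_of_nonneg (sub_nonneg.2 (expQuot_mono x h)), abs_of_nonneg (sub_nonneg.2 h)]
    exact expQuot_sub_le x hv h

/-- Under a negative drift, a bounded subharmonic function vanishing at `-∞` is non-positive. -/
lemma nonpos_of_subharmonic (τ : Measure ℝ) [IsProbabilityMeasure τ]
    (hdrift : ∫⁻ y, ENNReal.ofReal y ∂τ < ∫⁻ y, ENNReal.ofReal (-y) ∂τ) {d : ℝ → ℝ}
    (hd : Measurable d) {B : ℝ} (hB : ∀ x, |d x| ≤ B) (hlim : Tendsto d atBot (𝓝 0))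
    (hsub : ∀ x, d x ≤ ∫ y, d (x + y) ∂τ) (x : ℝ) : d x ≤ 0 := by
  -- The drift inequality needs a monotone function. The running supremum of `d` is monotone,
  -- remains subharmonic and still vanishes at `-∞`.
  set D : ℝ → ℝ := fun x => ⨆ y : Set.Iic x, d y with hD
  have hbdd : ∀ x : ℝ, BddAbove (Set.range fun y : Set.Iic x => d y) := fun x =>
    ⟨B, by rintro _ ⟨y, rfl⟩; exact (le_abs_self _).trans (hB _)⟩
  have hne : ∀ x : ℝ, Nonempty (Set.Iic x) := fun x => ⟨⟨x, Set.mem_Iic.2 le_rfl⟩⟩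
  have hle : ∀ {y x : ℝ}, y ≤ x → d y ≤ D x := fun {y x} h => le_ciSup (hbdd x) ⟨y, h⟩
  have hDle : ∀ {x c : ℝ}, (∀ y ≤ x, d y ≤ c) → D x ≤ c := fun {x c} h =>
    ciSup_le fun y => h y y.2
  have hDmono : Monotone D := fun x y h => hDle fun z hz => hle (hz.trans h)
  have hDB : ∀ x, |D x| ≤ B := fun x => abs_le.2
    ⟨(abs_le.1 (hB x)).1.trans (hle le_rfl), hDle fun y _ => (le_abs_self _).trans (hB y)⟩
  have hDbot : Tendsto D atBot (𝓝 0) := by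
    rw [Metric.tendsto_nhds]
    intro ε hε
    have h1 := (Metric.tendsto_nhds.1 hlim) (ε / 2) (by linarith)
    obtain ⟨x₀, hx₀⟩ := eventually_atBot.1 h1
    filter_upwards [eventually_le_atBot x₀] with x hx
    simp only [Real.dist_eq, sub_zero] at hx₀ ⊢
    have h2 : D x ≤ ε / 2 := hDle fun y hy =>
      (le_abs_self _).trans (hx₀ y (hy.trans hx)).le
    have h3 : -(ε / 2) ≤ D x := (neg_le_of_abs_le (hx₀ x hx).le).trans (hle le_rfl)
    rw [abs_lt]
    constructor <;> linarith
  obtain ⟨b, hb⟩ : ∃ b, Tendsto D atTop (𝓝 b) :=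
    ⟨_, tendsto_atTop_ciSup hDmono ⟨B, by rintro _ ⟨y, rfl⟩; exact (le_abs_self _).trans (hDB y)⟩⟩
  have hDsub : ∀ x, D x ≤ (∫ y, D (x + y) ∂τ) + 0 := fun x => by
    rw [add_zero]
    exact hDle fun y hy => (hsub y).trans (integral_mono (integrable_translate hd hB τ y)
      (integrable_translate hDmono.measurable hDB τ x) fun z => hle (by linarith))
  have hmain := drift_le_of_subharmonic hDmono hDbot hb τ (k := fun _ => 0) (fun _ => le_rfl) hDsub
  simp only [sub_zero, ENNReal.ofReal_zero, lintegral_zero, add_zero] at hmain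
  have hb0 : b ≤ 0 := by
    by_contra! hpos
    exact absurd ((ENNReal.mul_le_mul_iff_right (by simpa using hpos)
      ENNReal.ofReal_ne_top).1 hmain) (not_le.2 hdrift)
  exact (hle le_rfl).trans ((hDmono.ge_of_tendsto hb x).trans hb0)

lemma eq_of_isNonzeroSolution {τ μ ν : Measure ℝ} [IsProbabilityMeasure τ]
    (hdrift : ∫⁻ y, ENNReal.ofReal y ∂τ < ∫⁻ y, ENNReal.ofReal (-y) ∂τ)
    (hμ : IsNonzeroSolution (τ.map Real.exp) μ) (hν : IsNonzeroSolution (τ.map Real.exp) ν)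
    (hmean : mean μ = mean ν) : μ = ν := by
  obtain ⟨_, hμ0, hμi, hμpos, hμeq⟩ := (isNonzeroSolution_iff τ μ).1 hμ
  obtain ⟨_, hν0, hνi, hνpos, hνeq⟩ := (isNonzeroSolution_iff τ ν).1 hν
  rw [mean_eq_ofReal_integral hμ0 hμi, mean_eq_ofReal_integral hν0 hνi,
    ENNReal.ofReal_eq_ofReal_iff hμpos.le hνpos.le] at hmean
  have hd := nonpos_of_subharmonic τ hdrift (d := fun x => |profile μ x - profile ν x|)
    (((profile_anti hμ0).measurable.sub (profile_anti hν0).measurable).abs)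
    (B := (∫ t, t ∂μ) + ∫ t, t ∂ν) (fun x => by
      rw [abs_abs]
      exact (abs_sub _ _).trans (add_le_add (abs_profile_le hμ0 hμi x) (abs_profile_le hν0 hνi x)))
    (by
      -- Each profile tends to its mean at `-∞`, so equal means cancel.
      have := ((tendsto_profile_atBot hμ0 hμi).sub (tendsto_profile_atBot hν0 hνi)).abs
      simpa [hmean] using this)
    (fun x => by
      rw [profile_eq_expQuot hμ0 hμeq x, profile_eq_expQuot hν0 hνeq x]
      refine (abs_expQuot_sub_le x (integral_nonneg fun y => profile_nonneg hμ0 _)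
        (integral_nonneg fun y => profile_nonneg hν0 _)).trans ?_
      rw [← integral_sub (integrable_profile_translate hμ0 hμi τ x)
        (integrable_profile_translate hν0 hνi τ x)]
      exact abs_integral_le_integral_abs)
  refine ext_of_laplace hμ0 hν0 fun s hs => ?_
  have h1 : profile μ (Real.log s) = profile ν (Real.log s) :=
    sub_eq_zero.1 (abs_nonpos_iff.1 (hd (Real.log s)))
  rw [profile_eq hμ0, profile_eq hν0, Real.exp_log hs] at h1
  have := mul_left_cancel₀ (Real.exp_pos _).ne' h1
  linarith

/-! ### Existence -/

lemma profile_eq_of_laplace_eq_ofProfile {μ : Measure ℝ} [IsProbabilityMeasure μ]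
    (hμ : ∀ᵐ x ∂μ, 0 ≤ x) {h : ℝ → ℝ} (hl : ∀ s, 0 < s → laplace μ s = ofProfile h s) (x : ℝ) :
    profile μ x = h x := by
  rw [profile_eq hμ, hl _ (Real.exp_pos x), ofProfile, Real.log_exp, sub_sub_cancel, ← mul_assoc,
    ← Real.exp_add]
  simp

/-- As `x` decreases to `-∞` the integrands increase to `t`, so monotone convergence bounds the mean
by `1`. -/
lemma integrable_of_profile_le_one {μ : Measure ℝ} [IsProbabilityMeasure μ]
    (hμ : ∀ᵐ x ∂μ, 0 ≤ x) (hp : ∀ x, profile μ x ≤ 1) : Integrable (fun x => x) μ := by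
  refine integrable_of_mean_ne_top hμ (ne_top_of_le_ne_top ENNReal.one_ne_top ?_)
  have hlim : Tendsto (fun n : ℕ => ∫⁻ t, ENNReal.ofReal (expQuot (-n) t) ∂μ) atTop
      (𝓝 (mean μ)) := by
    refine lintegral_tendsto_of_tendsto_of_monotone
      (fun n => (expQuot_continuous _).measurable.ennreal_ofReal.aemeasurable)
      (Eventually.of_forall fun t m n hmn => ?_) (hμ.mono fun t ht => ?_)
    · refine ENNReal.ofReal_le_ofReal (expQuot_anti_left t (neg_le_neg ?_))
      exact_mod_cast hmn
    · exact ENNReal.tendsto_ofReal ((tendsto_expQuot_left ht).comp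
        (tendsto_neg_atTop_atBot.comp tendsto_natCast_atTop_atTop))
  refine le_of_tendsto' hlim fun n => ?_
  rw [← ofReal_integral_eq_lintegral_ofReal (integrable_expQuot hμ _)
    (hμ.mono fun t ht => expQuot_nonneg _ ht)]
  exact ENNReal.ofReal_le_one.2 (hp _)

lemma exists_isNonzeroSolution (τ : Measure ℝ) [IsProbabilityMeasure τ]
    (hdrift : ∫⁻ y, ENNReal.ofReal y ∂τ < ∫⁻ y, ENNReal.ofReal (-y) ∂τ) :
    ∃ μ, IsNonzeroSolution (τ.map Real.exp) μ := by
  obtain ⟨μ, hprob, hμ, hl⟩ := isLaplaceTransform_ofProfile_limitProfile τ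
  have hpr := profile_eq_of_laplace_eq_ofProfile hμ hl
  have hp := isProfile_limitProfile τ
  have hi := integrable_of_profile_le_one hμ fun x => by rw [hpr]; exact hp.le_one x
  refine ⟨μ, (isNonzeroSolution_iff τ μ).2 ⟨hprob, hμ, hi, ?_, fun s hs => ?_⟩⟩
  -- One non-zero value of the limit profile already makes the mean positive; its exact value is
  -- irrelevant, as `rescale` adjusts it.
  · obtain ⟨x, hx⟩ := limitProfile_ne_zero τ hdrift
    have := profile_le hμ hi x
    rw [hpr] at this
    exact ((hp.nonneg x).lt_of_ne' hx).trans_le this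
  · have h1 := exponent_exp hμ τ (Real.log s)
    simp only [hpr, Real.exp_log hs] at h1
    rw [hl s hs, ofProfile, ← step_limitProfile, step, mul_expQuot_log hs, sub_sub_cancel, h1]

/-- The equation is homogeneous: scaling `η` by `c` replaces `s` by `s * c` in both `laplace` and
`exponent`. -/
lemma IsNonzeroSolution.rescale {τ μ : Measure ℝ} [IsProbabilityMeasure τ]
    (h : IsNonzeroSolution (τ.map Real.exp) μ) {m : ℝ} (hm : 0 < m) :
    ∃ ν, IsNonzeroSolution (τ.map Real.exp) ν ∧ mean ν = ENNReal.ofReal m := by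
  obtain ⟨_, hμ, hi, hpos, heq⟩ := (isNonzeroSolution_iff τ μ).1 h
  set c : ℝ := m / ∫ x, x ∂μ with hc
  have hc0 : 0 < c := div_pos hm hpos
  have hmul : AEMeasurable (fun x => c * x) μ := by fun_prop
  have hν : IsProbabilityMeasure (μ.map fun x => c * x) := Measure.isProbabilityMeasure_map hmul
  have hν0 : ∀ᵐ x ∂(μ.map fun x => c * x), 0 ≤ x :=
    (ae_map_iff hmul measurableSet_Ici).2 (hμ.mono fun x hx => mul_nonneg hc0.le hx)
  have hνi : Integrable (fun x => x) (μ.map fun x => c * x) :=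
    (integrable_map_measure (by fun_prop) hmul).2 (hi.const_mul c)
  have hνm : ∫ x, x ∂(μ.map fun x => c * x) = m := by
    rw [integral_map hmul (by fun_prop), integral_const_mul, hc, div_mul_cancel₀ _ hpos.ne']
  have hνl : ∀ s, laplace (μ.map fun x => c * x) s = laplace μ (s * c) := fun s => by
    rw [laplace, integral_map hmul (by fun_prop), laplace]
    simp only [mul_assoc]
  refine ⟨μ.map fun x => c * x, (isNonzeroSolution_iff τ _).2 ⟨hν, hν0, hνi, hνm.symm ▸ hm,
    fun s hs => ?_⟩, by rw [mean_eq_ofReal_integral hν0 hνi, hνm]⟩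
  rw [hνl, heq _ (mul_pos hs hc0), exponent, exponent]
  simp only [hνl, mul_right_comm s c]

/-! ### The proposition -/

lemma extendedExpectation_neg_iff {Ω : Type*} [MeasurableSpace Ω] {P : Measure Ω} {f : Ω → ℝ}
    (hf : ExpectationExists P f) : extendedExpectation P f < 0 ↔
      ∫⁻ ω, ENNReal.ofReal (f ω) ∂P < ∫⁻ ω, ENNReal.ofReal (-f ω) ∂P := by
  rw [extendedExpectation, ← EReal.coe_ennreal_lt_coe_ennreal_iff]
  refine EReal.sub_neg ?_ ?_
  · rcases hf with h | h
    · exact Or.inl (by simpa using h)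
    · exact Or.inr (by simpa using h)
  · exact Or.inl (by simp)

end SizeBiasedPerpetuity

open SizeBiasedPerpetuity in
theorem proposition1p1 {Ω : Type*} [MeasurableSpace Ω] (P : MeasureTheory.Measure Ω)
    [MeasureTheory.IsProbabilityMeasure P] (A : Ω → ℝ) (hA : Measurable A)
    (hA_nonneg : ∀ᵐ ω ∂P, 0 ≤ A ω) (hA_zero : P {ω | A ω = 0} = 0)
    (hlog : SizeBiasedPerpetuity.ExpectationExists P (fun ω => Real.log (A ω))) :
    ((∃ μ : MeasureTheory.Measure ℝ, SizeBiasedPerpetuity.IsNonzeroSolution (P.map A) μ) ↔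
      SizeBiasedPerpetuity.extendedExpectation P (fun ω => Real.log (A ω)) < 0) ∧
    (SizeBiasedPerpetuity.extendedExpectation P (fun ω => Real.log (A ω)) < 0 →
      ∀ m : ℝ, 0 < m →
        ∃! μ : MeasureTheory.Measure ℝ,
          SizeBiasedPerpetuity.IsNonzeroSolution (P.map A) μ ∧
            SizeBiasedPerpetuity.mean μ = ENNReal.ofReal m) := by
  have hL : Measurable fun ω => Real.log (A ω) := hA.log
  set τ : Measure ℝ := P.map fun ω => Real.log (A ω) with hτ
  have : IsProbabilityMeasure τ := Measure.isProbabilityMeasure_map hL.aemeasurable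
  have hlaw : P.map A = τ.map Real.exp := by
    rw [hτ, Measure.map_map Real.measurable_exp hL]
    refine Measure.map_congr ?_
    -- Since `Real.log 0 = 0`, exponentiating the logarithm fails to return `A` where `A = 0`; this
    -- set is null.
    have h0 : ∀ᵐ ω ∂P, A ω ≠ 0 := by rw [ae_iff]; simpa using hA_zero
    filter_upwards [hA_nonneg, h0] with ω h1 h2
    exact (Real.exp_log (h1.lt_of_ne' h2)).symm
  have epos : ∫⁻ y, ENNReal.ofReal y ∂τ = ∫⁻ ω, ENNReal.ofReal (Real.log (A ω)) ∂P :=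
    lintegral_map (by fun_prop) hL
  have eneg : ∫⁻ y, ENNReal.ofReal (-y) ∂τ = ∫⁻ ω, ENNReal.ofReal (-Real.log (A ω)) ∂P :=
    lintegral_map (by fun_prop) hL
  rw [extendedExpectation_neg_iff hlog, ← epos, ← eneg, hlaw]
  refine ⟨⟨fun ⟨μ, hμ⟩ => drift_neg_of_isNonzeroSolution (by rw [epos, eneg]; exact hlog) hμ,
    exists_isNonzeroSolution τ⟩, fun hdrift m hm => ?_⟩
  obtain ⟨μ, hμ⟩ := exists_isNonzeroSolution τ hdrift
  obtain ⟨ν, hν, hνm⟩ := hμ.rescale hm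
  exact ⟨ν, ⟨hν, hνm⟩, fun κ hκ => eq_of_isNonzeroSolution hdrift hκ.1 hν (hκ.2.trans hνm.symm)⟩
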